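/- **Theorem.** Let $d\ge 1$ and let $p(i,j)$ be a Markov transition function on $\mathbb Z^d$ that is symmetric, translation invariant ($p(i,j)=p(0,j-i)$), of finite range and irreducible. Let $\Gamma=(\Gamma_{ab})$, $\Gamma_{ab}=\sum_{z\in\mathbb Z^d}p(0,z)z_az_b$, be the covariance matrix of one jump, and let $$p_t(i,j)=\sum_{n\ge 0}e^{-t}\frac{t^n}{n!}\,p^{(n)}(i,j)$$ be the transition probabilities of the rate-one continuous-time walk with jump kernel $p$, where $p^{(n)}$ are the $n$-step probabilities. For $\mathbf x=(x_1,\dots,x_k)$ and $\mathbf y=(y_1,\dots,y_k)$ in $(\mathbb Z^d)^k$, $k\in\mathbb N=\{0,1,2,\dots\}$, put $p_t(\mathbf x,\mathbf y)=\prod_{i=1}^k p_t(x_i,y_i)$ (labeled independent walkers). Let $\rho>0$, let $\nu_\rho$ be the product measure on $\mathbb N^{\mathbb Z^d}$ with Poisson($\rho$) marginals, and let $\{\eta(t):t\ge0\}$ be the system of independent random walkers with $\eta(0)\sim\nu_\rho$: given $\eta(0)$, all particles perform independent rate-one continuous-time walks with kernel $p$, and $\eta_y(t)$ is the number of particles at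 $y$ at time $t$. Fix a normalization $c\in\mathbb R\setminus\{0\}$ and set $$d(m,n)=c^m\sum_{j=0}^m\binom mj\Big(-\frac1\rho\Big)^j\frac{n!}{(n-j)!},\qquad D(\xi,\eta)=\prod_{i\in\mathbb Z^d}d(\xi_i,\eta_i),\qquad a(\xi)=\int D(\xi,\eta)^2\,d\nu_\rho(\eta)$$ for finite configurations $\xi$, where $n!/(n-j)!$ is read as $0$ for $j>n$ ($c=1$ is the ${}_2F_0$ Charlier normalization, and $c=-\rho$ the monic one). For $\mathbf x\in(\mathbb Z^d)^k$ let $\xi(\mathbf x)=\sum_{i=1}^k\delta_{x_i}$ and $\hat\tau_z\mathbf x=(z+x_1,\dots,z+x_k)$. Let $\mathcal P_k(\mathbf x)$ be the set of permutations of $\{1,\dots,k\}$ modulo the relation $\sigma\sim\sigma'$ iff $x_{\sigma(i)}=x_{\sigma'(i)}$ for all $i$, and let $\mathbf x^{(\sigma)}=(x_{\sigma(1)},\dots,x_{\sigma(k)})$. For a real Schwartz function $\phi$ on $\mathbb R^d$ and an integer $N\ge 1$ let $$X_N(\mathbf x,\eta,\phi)=\sum_{z\in\mathbb Z^d}\phi\Big(\frac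 zN\Big)D\big(\xi(\hat\tau_z\mathbf x),\eta\big).$$ 1. For all $N\ge1$ and $t>0$, the series defining $X_N(\mathbf x,\eta(t),\phi)$ and $X_N(\mathbf x,\eta(0),\phi)$ converge absolutely almost surely, their product is integrable, the double series below converge absolutely, and $$\mathbb E_{\nu_\rho}\big[X_N(\mathbf x,\eta(t),\phi)X_N(\mathbf x,\eta(0),\phi)\big]=a(\xi(\mathbf x))\sum_{\sigma\in\mathcal P_k(\mathbf x)}\sum_{y,z\in\mathbb Z^d}\phi\Big(\frac yN\Big)\phi\Big(\frac zN\Big)p_t\big(\mathbf x,\hat\tau_{z-y}\mathbf x^{(\sigma)}\big).$$ 2. For all $t>0$, $$\lim_{N\to\infty}N^{d(k-2)}\,\mathbb E_{\nu_\rho}\big[X_N(\mathbf x,\eta(N^2t),\phi)X_N(\mathbf x,\eta(0),\phi)\big]=\frac{|\mathcal P_k(\mathbf x)|\,a(\xi(\mathbf x))}{(\det\Gamma)^{k/2}(2\pi t)^{dk/2}}\iint_{\mathbb R^{2d}}e^{-k(z-y)\cdot\Gamma^{-1}(z-y)/2t}\,\phi(z)\phi(y)\,dz\,dy.$$ In particular,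 if $\Gamma=\frac1d I$ (for instance for the simple random walk), the limit equals $$|\mathcal P_k(\mathbf x)|\,a(\xi(\mathbf x))\,\frac{d^{dk/2}}{(2\pi t)^{dk/2}}\iint_{\mathbb R^{2d}}e^{-kd|z-y|^2/2t}\,\phi(z)\phi(y)\,dz\,dy.$$ -/

import Mathlib

open MeasureTheory ProbabilityTheory Filter Topology
open scoped NNReal

namespace IRW

noncomputable section

/-- The lattice `ℤ^d`. -/
abbrev Lattice (d : ℕ) : Type := Fin d → ℤ

/-- Particle configurations `η : ℤ^d → ℕ`. -/
abbrev Config (d : ℕ) : Type := Lattice d → ℕ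

/-- A symmetric, translation invariant, finite range, irreducible Markov transition function
on `ℤ^d`. -/
structure IsWalkKernel {d : ℕ} (p : Lattice d → Lattice d → ℝ) : Prop where
  nonneg : ∀ i j, 0 ≤ p i j
  symm : ∀ i j, p i j = p j i
  translation : ∀ i j, p i j = p 0 (j - i)
  sum_one : ∀ i, HasSum (p i) 1
  finite_range : ∃ R : ℝ, 0 < R ∧ ∀ i j, R < ‖i - j‖ → p i j = 0
  irreducible : ∀ i j, Relation.ReflTransGen (fun a b => 0 < p a b) i j

/-- `n`-step transition probabilities of the discrete time walk with kernel `p`. -/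
def stepProb {d : ℕ} (p : Lattice d → Lattice d → ℝ) : ℕ → Lattice d → Lattice d → ℝ
  | 0, i, j => if i = j then 1 else 0
  | n + 1, i, j => ∑' l, stepProb p n i l * p l j

/-- Transition probabilities `p_t(i,j)` of the continuous time walk that jumps at the times of a
rate one Poisson process, each jump being made according to `p`. -/
def walkProb {d : ℕ} (p : Lattice d → Lattice d → ℝ) (t : ℝ≥0) (i j : Lattice d) : ℝ :=
  ∑' n : ℕ, Real.exp (-(t : ℝ)) * (t : ℝ) ^ n / (n.factorial : ℝ) * stepProb p n i j

/-- Transition probabilities `p_t(x,y)` of `k` labeled independent walkers. -/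
def labeledProb {d k : ℕ} (p : Lattice d → Lattice d → ℝ) (t : ℝ≥0)
    (x y : Fin k → Lattice d) : ℝ :=
  ∏ i, walkProb p t (x i) (y i)

/-- The process `Y` is a continuous time random walk with rate one and jump kernel `p`,
started from `x`. -/
structure IsWalk {d : ℕ} {Ω : Type*} [MeasurableSpace Ω] (p : Lattice d → Lattice d → ℝ)
    (P : Measure Ω) (x : Lattice d) (Y : ℝ≥0 → Ω → Lattice d) : Prop where
  measurable : ∀ t, Measurable (Y t)
  start : ∀ᵐ ω ∂P, Y 0 ω = x
  indep_increments : HasIndepIncrements Y P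
  increment_law : ∀ (s t : ℝ≥0) (z : Lattice d),
    P {ω | Y (s + t) ω - Y s ω = z} = ENNReal.ofReal (walkProb p t 0 z)
  right_continuous : ∀ᵐ ω ∂P, ∀ t, ContinuousWithinAt (fun s => Y s ω) (Set.Ici t) t

/-- The product measure `ν_ρ` on configurations with Poisson(`ρ`) marginals. -/
def poissonField (d : ℕ) (ρ : ℝ≥0) : Measure (Config d) :=
  Measure.infinitePi (fun _ : Lattice d => poissonMeasure ρ)

/-- `η` is the system of independent random walkers with jump kernel `p` started from `ν_ρ`.
The particles initially at site `x` carry the labels `(x, i)` with `i < η_x(0)`. Given the initial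
configuration, every particle performs its own walk, independently of all others, and `η_y(t)`
is the number of particles that are at `y` at time `t`. -/
def IsEquilibriumWalkers {d : ℕ} {Ω : Type*} [MeasurableSpace Ω]
    (p : Lattice d → Lattice d → ℝ) (ρ : ℝ≥0) (P : Measure Ω) (η : ℝ≥0 → Ω → Config d) : Prop :=
  HasLaw (η 0) (poissonField d ρ) P ∧
  ∃ Y : Lattice d × ℕ → ℝ≥0 → Ω → Lattice d,
    (∀ l, IsWalk p P l.1 (Y l)) ∧
    iIndepFun (fun l ω (t : ℝ≥0) => Y l t ω) P ∧
    IndepFun (η 0) (fun ω (l : Lattice d × ℕ) (t : ℝ≥0) => Y l t ω) P ∧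
    ∀ t, ∀ᵐ ω ∂P, ∀ y,
      (η t ω y : ℕ∞) = Set.encard {l : Lattice d × ℕ | l.2 < η 0 ω l.1 ∧ Y l t ω = y}

/-- Single site Charlier polynomial
`c^k ₂F₀(-k, -n; -; -1/ρ) = c^k ∑_j (k choose j) (-1/ρ)^j n!/(n-j)!`.
The choice `c = 1` is the normalization with `d(k+1,n) = d(k,n) - (n/ρ) d(k,n-1)`, and `c = -ρ`
gives the monic polynomial. -/
def charlier (ρ : ℝ≥0) (c : ℝ) (k n : ℕ) : ℝ :=
  c ^ k * ∑ j ∈ Finset.range (k + 1),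
    (k.choose j : ℝ) * (-1 / (ρ : ℝ)) ^ j * (n.descFactorial j : ℝ)

/-- The orthogonal polynomial `D(ξ,η) = ∏_i d(ξ_i, η_i)`, for `ξ` a finite configuration. -/
def duality {d : ℕ} (ρ : ℝ≥0) (c : ℝ) (ξ : Lattice d →₀ ℕ) (η : Config d) : ℝ :=
  ξ.prod fun i m => charlier ρ c m (η i)

/-- `a(ξ) = ‖D(ξ,·)‖²` in `L²(ν_ρ)`. -/
def dualityNormSq {d : ℕ} (ρ : ℝ≥0) (c : ℝ) (ξ : Lattice d →₀ ℕ) : ℝ :=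
  ∫ η, duality ρ c ξ η ^ 2 ∂(poissonField d ρ)

/-- The configuration `ξ(x)` of a vector `x = (x_1, …, x_k)` of particle positions. -/
def configOf {d k : ℕ} (x : Fin k → Lattice d) : Lattice d →₀ ℕ :=
  ∑ i, Finsupp.single (x i) 1

/-- The shift `(z + x_1, …, z + x_k)`. -/
def shift {d k : ℕ} (z : Lattice d) (x : Fin k → Lattice d) : Fin k → Lattice d :=
  fun i => z + x i

/-- The point `z / N` of `ℝ^d`. -/
def scaled {d : ℕ} (N : ℕ) (z : Lattice d) : EuclideanSpace ℝ (Fin d) :=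
  WithLp.toLp 2 fun i => (z i : ℝ) / (N : ℝ)

/-- The summand `φ(z/N) D(τ̂_z x, η)` of the fluctuation field. -/
def fieldTerm {d k : ℕ} (ρ : ℝ≥0) (c : ℝ) (N : ℕ) (x : Fin k → Lattice d) (η : Config d)
    (φ : EuclideanSpace ℝ (Fin d) → ℝ) (z : Lattice d) : ℝ :=
  φ (scaled N z) * duality ρ c (configOf (shift z x)) η

/-- The `k`-th order fluctuation field `X_N(x,η,φ)`. -/
def field {d k : ℕ} (ρ : ℝ≥0) (c : ℝ) (N : ℕ) (x : Fin k → Lattice d) (η : Config d)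
    (φ : EuclideanSpace ℝ (Fin d) → ℝ) : ℝ :=
  ∑' z, fieldTerm ρ c N x η φ z

/-- Two permutations are equivalent modulo `x` if they rearrange `x` in the same way. -/
def permSetoid {d k : ℕ} (x : Fin k → Lattice d) : Setoid (Equiv.Perm (Fin k)) where
  r σ σ' := ∀ i, x (σ i) = x (σ' i)
  iseqv := ⟨fun _ _ => rfl, fun h i => (h i).symm, fun h h' i => (h i).trans (h' i)⟩

/-- The set `P_k(x)` of permutations modulo `x`. -/
abbrev PermClass {d k : ℕ} (x : Fin k → Lattice d) : Type := Quotient (permSetoid x)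

instance {d k : ℕ} (x : Fin k → Lattice d) : Fintype (PermClass x) := Fintype.ofFinite _

/-- The rearranged vector `x^{(σ)}`, with `x^{(σ)}_i = x_{σ(i)}`. -/
def permuted {d k : ℕ} (x : Fin k → Lattice d) (σ : PermClass x) : Fin k → Lattice d :=
  Quotient.lift (fun (σ : Equiv.Perm (Fin k)) i => x (σ i)) (fun _ _ h => funext h) σ

/-- The covariance matrix `Γ_{ij} = ∑_z p(0,z) z_i z_j` of one jump. -/
def jumpCov {d : ℕ} (p : Lattice d → Lattice d → ℝ) : Matrix (Fin d) (Fin d) ℝ :=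
  Matrix.of fun i j => ∑' z : Lattice d, p 0 z * (z i : ℝ) * (z j : ℝ)

/-- The quadratic form `v · M v`. -/
def quadForm {d : ℕ} (M : Matrix (Fin d) (Fin d) ℝ) (v : EuclideanSpace ℝ (Fin d)) : ℝ :=
  dotProduct (WithLp.ofLp v) (M.mulVec (WithLp.ofLp v))

end

end IRW

/-! The correlation formula is a self-duality argument. By its definition through falling
factorials, `duality` applied to `configOf x` is a signed sum over subsets `S` of the labels, each
term counting injective choices of particles at the sites `x i`, `i ∈ S`
(`duality_configOf_eq_sum`). Distinct particles move independently, and the number of ways to choose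
them at time zero is again a product of falling factorials, so a falling factorial at time `t` is,
on average, one at time zero evaluated at random sites (`lintegral_fallingProd_mul`). By symmetry of
the kernel, these sites are the positions of independent walkers started from `x`.

Hence the covariance of two duality polynomials at times `t` and `0` averages, over the dual
walkers, the inner product of two Charlier products under the Poisson field. Orthogonality leaves
only the event that the dual walkers end in a rearrangement of the second vector, which gives the
sum over `PermClass` (`Evolution.integral_duality_mul_duality`). Moment bounds that do not depend on
the sites, with the decay of `φ`, justify summing over all shifts (`Evolution.field_correlation`).

For the limit, write `N^(d(k-2))` as `N^(-2d)` times one factor `N^d` for each of the `k` walkers.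
Each factor `N^d` turns a transition probability into a Gaussian density, by the local limit theorem
(`IsWalkKernel.tendsto_pow_mul_walkProb`), and `N^(-2d)` turns the double sum into a double integral
(`tendsto_double_sum`). The fixed offsets between the walkers disappear after division by `N`, so
all classes of permutations contribute equally. The local limit theorem comes from Fourier inversion
on the torus, where irreducibility gives a quadratic lower bound for one minus the characteristic
function. -/

namespace IRW

/-! ### Charlier polynomials and the Poisson distribution. -/

/-- Functions on `ℕ` of at most exponential growth. -/
def ExpBounded (f : ℕ → ℝ) : Prop := ∃ C : ℝ, 1 ≤ C ∧ ∀ n, |f n| ≤ C ^ (n + 1)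

namespace ExpBounded

/-- The exponent `n + 1` in `ExpBounded` lets a single `C ≥ 1` serve as both prefactor and growth
rate, which keeps the closure properties simple. -/
lemma const (a : ℝ) : ExpBounded fun _ => a := by
  refine ⟨|a| + 1, by linarith [abs_nonneg a], fun n => ?_⟩
  have h : (1 : ℝ) ≤ |a| + 1 := by linarith [abs_nonneg a]
  calc |a| ≤ |a| + 1 := by linarith
    _ = (|a| + 1) ^ 1 := by ring
    _ ≤ _ := pow_le_pow_right₀ h (by omega)

lemma natCast : ExpBounded fun n => (n : ℝ) := by
  refine ⟨2, by norm_num, fun n => ?_⟩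
  rw [abs_of_nonneg (by positivity)]
  show (n : ℝ) ≤ 2 ^ (n + 1)
  exact_mod_cast (Nat.lt_two_pow_self.le.trans (Nat.pow_le_pow_right (by norm_num) (by omega)) :
    n ≤ 2 ^ (n + 1))

variable {f g : ℕ → ℝ}

lemma mul (hf : ExpBounded f) (hg : ExpBounded g) : ExpBounded fun n => f n * g n := by
  obtain ⟨C, hC, hf⟩ := hf
  obtain ⟨D, hD, hg⟩ := hg
  refine ⟨C * D, one_le_mul_of_one_le_of_one_le hC hD, fun n => ?_⟩
  rw [abs_mul, mul_pow]
  exact mul_le_mul (hf n) (hg n) (abs_nonneg _) (by positivity)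

lemma add (hf : ExpBounded f) (hg : ExpBounded g) : ExpBounded fun n => f n + g n := by
  obtain ⟨C, hC, hf⟩ := hf
  obtain ⟨D, hD, hg⟩ := hg
  refine ⟨C + D, by linarith, fun n => (abs_add_le _ _).trans ((add_le_add (hf n) (hg n)).trans ?_)⟩
  exact pow_add_pow_le (by linarith) (by linarith) (by omega)

lemma sum {ι : Type*} (s : Finset ι) {F : ι → ℕ → ℝ} (h : ∀ i ∈ s, ExpBounded (F i)) :
    ExpBounded fun n => ∑ i ∈ s, F i n := by
  classical
  induction s using Finset.induction_on with
  | empty => simpa using const 0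
  | insert a s ha ih =>
    simp only [Finset.sum_insert ha]
    exact (h a (by simp)).add (ih fun i hi => h i (by simp [hi]))

lemma pow (hf : ExpBounded f) (k : ℕ) : ExpBounded fun n => f n ^ k := by
  induction k with
  | zero => simpa using const 1
  | succ k ih => simpa only [pow_succ] using ih.mul hf

lemma mono (hf : ExpBounded f) (h : ∀ n, |g n| ≤ |f n|) : ExpBounded g := by
  obtain ⟨C, hC, hf⟩ := hf
  exact ⟨C, hC, fun n => (h n).trans (hf n)⟩

lemma comp_succ (hf : ExpBounded f) : ExpBounded fun n => f (n + 1) := by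
  obtain ⟨C, hC, hf⟩ := hf
  refine ⟨C ^ 2, one_le_pow₀ hC, fun n => (hf _).trans ?_⟩
  rw [← pow_mul]
  exact pow_le_pow_right₀ hC (by omega)

lemma descFactorial (j : ℕ) : ExpBounded fun n => (n.descFactorial j : ℝ) := by
  refine (natCast.pow j).mono fun n => ?_
  rw [abs_of_nonneg (by positivity), abs_of_nonneg (by positivity)]
  exact_mod_cast Nat.descFactorial_le_pow n j

/-- The Poisson weights decay like `ρ ^ n / n!` and beat any geometric growth. -/
lemma integrable (hf : ExpBounded f) (ρ : ℝ≥0) : Integrable f (poissonMeasure ρ) := by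
  obtain ⟨C, hC, hf⟩ := hf
  rw [integrable_poissonMeasure_iff]
  have h := ((Real.summable_pow_div_factorial ((ρ : ℝ) * C)).mul_left (Real.exp (-ρ) * C))
  refine Summable.of_nonneg_of_le (fun n => by positivity) (fun n => ?_) h
  rw [Real.norm_eq_abs]
  calc Real.exp (-ρ) * (ρ : ℝ) ^ n / n.factorial * |f n|
      ≤ Real.exp (-ρ) * (ρ : ℝ) ^ n / n.factorial * C ^ (n + 1) := by
        gcongr; exact hf n
    _ = _ := by rw [mul_pow]; ring

end ExpBounded

lemma charlier_expBounded (ρ : ℝ≥0) (c : ℝ) (m : ℕ) : ExpBounded (charlier ρ c m) :=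
  (ExpBounded.const _).mul (ExpBounded.sum _ fun _ _ =>
    (ExpBounded.const _).mul (ExpBounded.descFactorial _))

@[simp] lemma charlier_zero (ρ : ℝ≥0) (c : ℝ) (n : ℕ) : charlier ρ c 0 n = 1 := by
  simp [charlier]

/-- The Poisson integration by parts formula. -/
lemma integral_poisson_mul_pred (ρ : ℝ≥0) {g : ℕ → ℝ} (hg : ExpBounded g) :
    ∫ n, (n : ℝ) * g n ∂(poissonMeasure ρ) = ρ * ∫ n, g (n + 1) ∂(poissonMeasure ρ) := by
  have h1 := hasSum_integral_poissonMeasure ((ExpBounded.natCast.mul hg).integrable ρ)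
  have h2 := (hasSum_integral_poissonMeasure (hg.comp_succ.integrable ρ)).mul_left (ρ : ℝ)
  -- The term `n = 0` vanishes; after the shift, `n + 1` cancels against `(n + 1)!` and one factor
  -- `ρ` is left over.
  rw [← hasSum_nat_add_iff' 1] at h1
  simp only [Finset.sum_range_one, Nat.cast_zero, zero_mul, smul_zero, sub_zero] at h1
  refine h1.unique (h2.congr_fun fun n => ?_)
  simp only [smul_eq_mul, Nat.factorial_succ, Nat.cast_mul, pow_succ]
  field_simp

/-- Raising relation, from Pascal's rule. The truncated `n - 1` at `n = 0` is harmless because of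
the factor `n`. -/
lemma charlier_succ (ρ : ℝ≥0) (c : ℝ) (m n : ℕ) :
    charlier ρ c (m + 1) n = c * (charlier ρ c m n - n / ρ * charlier ρ c m (n - 1)) := by
  have key : ∀ j : ℕ, ((n.descFactorial (j + 1) : ℕ) : ℝ) = n * ((n - 1).descFactorial j : ℕ) := by
    intro j
    cases n with
    | zero => simp
    | succ n => rw [Nat.succ_descFactorial_succ]; push_cast; simp
  have h1 : ∑ j ∈ Finset.range (m + 2), ((m + 1).choose j : ℝ) * (-1 / (ρ : ℝ)) ^ j *
        (n.descFactorial j : ℝ)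
      = ∑ j ∈ Finset.range (m + 1), (m.choose j : ℝ) * (-1 / (ρ : ℝ)) ^ j *
          (n.descFactorial j : ℝ)
        + ∑ j ∈ Finset.range (m + 1), (m.choose j : ℝ) * (-1 / (ρ : ℝ)) ^ (j + 1) *
          (n.descFactorial (j + 1) : ℝ) := by
    rw [Finset.sum_range_succ']
    simp only [Nat.choose_succ_succ, Nat.cast_add, add_mul, Finset.sum_add_distrib]
    have : ∑ j ∈ Finset.range (m + 1), (m.choose (j + 1) : ℝ) * (-1 / (ρ : ℝ)) ^ (j + 1) *
          (n.descFactorial (j + 1) : ℝ) + 1 = ∑ j ∈ Finset.range (m + 1), (m.choose j : ℝ) * (-1 / (ρ : ℝ)) ^ j *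
          (n.descFactorial j : ℝ) := by
      rw [Finset.sum_range_succ, Finset.sum_range_succ' _ m]
      simp
    rw [← this]
    simp
    ring
  have h2 : ∑ j ∈ Finset.range (m + 1), (m.choose j : ℝ) * (-1 / (ρ : ℝ)) ^ (j + 1) *
      (n.descFactorial (j + 1) : ℝ) = -(n / ρ) * ∑ j ∈ Finset.range (m + 1),
        (m.choose j : ℝ) * (-1 / (ρ : ℝ)) ^ j * ((n - 1).descFactorial j : ℝ) := by
    rw [Finset.mul_sum]
    exact Finset.sum_congr rfl fun j _ => by rw [key j]; ring
  simp only [charlier]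
  rw [h1, h2]
  ring

/-- Lowering relation: a forward difference lowers the order of a falling factorial by one, and the
factor it produces is absorbed by `(j + 1) * choose (m + 1) (j + 1) = (m + 1) * choose m j`. -/
lemma charlier_add_one (ρ : ℝ≥0) (c : ℝ) (m n : ℕ) :
    charlier ρ c (m + 1) (n + 1) = charlier ρ c (m + 1) n - c * (m + 1) / ρ * charlier ρ c m n := by
  have key : ∀ j : ℕ, (((n + 1).descFactorial (j + 1) : ℕ) : ℝ) =
      n.descFactorial (j + 1) + (j + 1) * (n.descFactorial j : ℕ) := by
    intro j
    rw [Nat.succ_descFactorial_succ, Nat.descFactorial_succ]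
    rcases le_or_gt j n with h | h
    · push_cast [h]; ring
    · simp [Nat.descFactorial_eq_zero_iff_lt.2 h]
  have key2 : ∀ j : ℕ, ((m + 1).choose (j + 1) : ℝ) * (j + 1) = (m + 1) * m.choose j := fun j => by
    exact_mod_cast (Nat.add_one_mul_choose_eq m j).symm
  simp only [charlier]
  rw [Finset.sum_range_succ' _ (m + 1), Finset.sum_range_succ' _ (m + 1)]
  rw [Finset.sum_congr rfl fun j _ => by
    rw [key j, show ((m + 1).choose (j + 1) : ℝ) * (-1 / (ρ : ℝ)) ^ (j + 1) *
      (n.descFactorial (j + 1) + (j + 1) * (n.descFactorial j : ℕ)) =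
      ((m + 1).choose (j + 1) : ℝ) * (-1 / (ρ : ℝ)) ^ (j + 1) * (n.descFactorial (j + 1) : ℕ) +
      (((m + 1).choose (j + 1) : ℝ) * (j + 1)) * ((-1 / (ρ : ℝ)) ^ (j + 1) *
        (n.descFactorial j : ℕ)) by ring, key2 j, show ((m : ℝ) + 1) * (m.choose j : ℝ) *
        ((-1 / (ρ : ℝ)) ^ (j + 1) * (n.descFactorial j : ℕ)) = -((m + 1) / ρ) *
        ((m.choose j : ℝ) * (-1 / (ρ : ℝ)) ^ j * (n.descFactorial j : ℕ)) by ring]]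
  rw [Finset.sum_add_distrib, ← Finset.mul_sum]
  simp
  ring

/-- Orthogonality of the Charlier polynomials with respect to the Poisson distribution. -/
lemma integral_charlier_mul_charlier (ρ : ℝ≥0) (hρ : 0 < ρ) (c : ℝ) {m n : ℕ} (h : m ≠ n) :
    ∫ j, charlier ρ c m j * charlier ρ c n j ∂(poissonMeasure ρ) = 0 := by
  have hρ' : (ρ : ℝ) ≠ 0 := by exact_mod_cast hρ.ne'
  -- By the Poisson integration by parts, the raising operator is adjoint to `-c` times the forward
  -- difference. As the difference lowers the degree, both degrees drop together until one is zero,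
  -- and the difference of a constant vanishes.
  have step : ∀ m n, ∫ j, charlier ρ c m j * charlier ρ c (n + 1) j ∂(poissonMeasure ρ) =
      c * ∫ j, (charlier ρ c m j - charlier ρ c m (j + 1)) * charlier ρ c n j
        ∂(poissonMeasure ρ) := by
    intro m n
    have hb : ExpBounded fun j => charlier ρ c m j * charlier ρ c n (j - 1) := by
      refine (charlier_expBounded ρ c m).mul ?_
      obtain ⟨C, hC, h⟩ := charlier_expBounded ρ c n
      exact ⟨C, hC, fun j => (h _).trans (pow_le_pow_right₀ hC (by omega))⟩
    have hi1 := ((charlier_expBounded ρ c m).mul (charlier_expBounded ρ c n)).integrable ρ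
    have hi2 := (ExpBounded.natCast.mul hb).integrable ρ
    have hi3 := ((charlier_expBounded ρ c m).comp_succ.mul (charlier_expBounded ρ c n)).integrable ρ
    have e := integral_poisson_mul_pred ρ hb
    simp only [Nat.add_sub_cancel] at e
    simp only [charlier_succ ρ c n, sub_mul]
    rw [integral_sub hi1 hi3, show (fun j : ℕ => charlier ρ c m j * (c * (charlier ρ c n j -
      (j : ℝ) / ρ * charlier ρ c n (j - 1)))) = fun j : ℕ => c * (charlier ρ c m j * charlier ρ c n j
        - 1 / ρ * (j * (charlier ρ c m j * charlier ρ c n (j - 1)))) by ext j; ring,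
      integral_const_mul, integral_sub hi1 (hi2.const_mul _), integral_const_mul, e]
    field_simp
  induction m generalizing n with
  | zero =>
    obtain ⟨n, rfl⟩ := Nat.exists_eq_succ_of_ne_zero h.symm
    rw [Nat.succ_eq_add_one, step]
    simp
  | succ m ih =>
    cases n with
    | zero =>
      have := step 0 m
      simp only [charlier_zero, sub_self, zero_mul, integral_zero, mul_zero, one_mul, mul_one]
        at this ⊢
      exact this
    | succ n =>
      have e : ∀ j, (charlier ρ c (m + 1) j - charlier ρ c (m + 1) (j + 1)) * charlier ρ c n j =
          c * (m + 1) / ρ * (charlier ρ c m j * charlier ρ c n j) := fun j => by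
        rw [charlier_add_one]; ring
      simp only [step, e, integral_const_mul, ih (fun h' => h (by rw [h'])), mul_zero]

/-- The binomial theorem bounds the sum by `(n / ρ + 1) ^ m`. The `m`-th power of one expression in
`n` is wanted, since it can be split into one factor per particle. -/
lemma abs_charlier_le (ρ : ℝ≥0) (c : ℝ) (m n : ℕ) :
    |charlier ρ c m n| ≤ (|c| * (1 + 1 / ρ)) ^ m * (1 + (n : ℝ)) ^ m := by
  have h : ∑ j ∈ Finset.range (m + 1), |(m.choose j : ℝ) * (-1 / (ρ : ℝ)) ^ j *
      (n.descFactorial j : ℝ)| ≤ (n / ρ + 1 : ℝ) ^ m := by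
    rw [add_pow]
    refine Finset.sum_le_sum fun j _ => ?_
    rw [abs_mul, abs_mul, abs_pow, abs_div]
    simp only [Nat.abs_cast, abs_neg, abs_one, one_pow, mul_one, NNReal.abs_eq, div_pow]
    calc (m.choose j : ℝ) * (1 / (ρ : ℝ) ^ j) * (n.descFactorial j : ℝ)
        ≤ (m.choose j : ℝ) * (1 / (ρ : ℝ) ^ j) * (n : ℝ) ^ j := by
          gcongr; exact_mod_cast Nat.descFactorial_le_pow n j
      _ = _ := by ring
  rw [charlier, abs_mul, abs_pow, mul_pow, mul_assoc, ← mul_pow]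
  gcongr
  refine (Finset.abs_sum_le_sum_abs _ _).trans (h.trans ?_)
  gcongr
  have : (0 : ℝ) ≤ 1 / ρ := by positivity
  have hn : (0 : ℝ) ≤ n := by positivity
  rw [div_eq_mul_one_div]
  nlinarith

end IRW

/-! ### Orthogonality and moment bounds under the Poisson field. -/

namespace IRW

section Field

variable {d : ℕ} (ρ : ℝ≥0)

instance : IsProbabilityMeasure (poissonField d ρ) := by
  unfold poissonField; infer_instance

/-- The integrand sees only the sites of `s`, so the infinite product measure may be replaced by its
finite marginal. -/
lemma integral_poissonField_prod (s : Finset (Lattice d)) (f : Lattice d → ℕ → ℝ) :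
    ∫ η, ∏ i ∈ s, f i (η i) ∂(poissonField d ρ) = ∏ i ∈ s, ∫ n, f i n ∂(poissonMeasure ρ) := by
  have h := integral_restrict_infinitePi (μ := fun _ : Lattice d => poissonMeasure ρ) (s := s)
    (f := fun η => ∏ i : s, f i (η i)) (Measurable.of_discrete.aestronglyMeasurable)
  rw [integral_fintype_prod_eq_prod (fun (i : s) n => f i n)] at h
  rw [← Finset.prod_coe_sort s (fun i => ∫ n, f i n ∂(poissonMeasure ρ)), ← h]
  refine integral_congr_ae (Eventually.of_forall fun η => ?_)
  exact (Finset.prod_coe_sort s (fun i => f i (η i))).symm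

lemma integrable_poissonField_prod (s : Finset (Lattice d)) {f : Lattice d → ℕ → ℝ}
    (hf : ∀ i ∈ s, ExpBounded (f i)) :
    Integrable (fun η => ∏ i ∈ s, f i (η i)) (poissonField d ρ) := by
  have h : Integrable (fun η : s → ℕ => ∏ i : s, f i (η i))
      (Measure.pi fun _ : s => poissonMeasure ρ) :=
    Integrable.fintype_prod (f := fun (i : s) n => f i n) fun i => (hf i i.2).integrable ρ
  rw [← Measure.infinitePi_map_restrict (μ := fun _ : Lattice d => poissonMeasure ρ)] at h
  refine (h.comp_measurable (by fun_prop)).congr (Eventually.of_forall fun η => ?_)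
  exact Finset.prod_coe_sort s (fun i => f i (η i))

lemma duality_eq_prod (c : ℝ) (ξ : Lattice d →₀ ℕ) (η : Config d) {s : Finset (Lattice d)}
    (hs : ξ.support ⊆ s) : duality ρ c ξ η = ∏ i ∈ s, charlier ρ c (ξ i) (η i) :=
  Finsupp.prod_of_support_subset _ hs _ (by simp)

/-- Orthogonality of the multivariate Charlier polynomials under the Poisson field. -/
lemma integral_duality_mul_duality (hρ : 0 < ρ) (c : ℝ) {ξ ξ' : Lattice d →₀ ℕ} (h : ξ ≠ ξ') :
    ∫ η, duality ρ c ξ η * duality ρ c ξ' η ∂(poissonField d ρ) = 0 := by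
  classical
  obtain ⟨i, hi⟩ := Finsupp.ne_iff.1 h
  have hs : i ∈ ξ.support ∪ ξ'.support := by
    by_contra h'
    simp only [Finset.mem_union, Finsupp.mem_support_iff, not_or, not_not] at h'
    exact hi (h'.1.trans h'.2.symm)
  simp only [duality_eq_prod ρ c ξ _ (Finset.subset_union_left (s₂ := ξ'.support)),
    duality_eq_prod ρ c ξ' _ (Finset.subset_union_right (s₁ := ξ.support)),
    ← Finset.prod_mul_distrib]
  rw [integral_poissonField_prod ρ _ fun i n => charlier ρ c (ξ i) n * charlier ρ c (ξ' i) n]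
  exact Finset.prod_eq_zero hs (integral_charlier_mul_charlier ρ hρ c hi)

/-- In this form the norm depends only on the multiplicities of `ξ`, not on where they sit; shift
invariance follows. -/
lemma dualityNormSq_eq_prod (c : ℝ) (ξ : Lattice d →₀ ℕ) :
    dualityNormSq ρ c ξ = ξ.prod fun _ m => ∫ n, charlier ρ c m n ^ 2 ∂(poissonMeasure ρ) := by
  simp only [dualityNormSq, duality, Finsupp.prod, ← Finset.prod_pow]
  exact integral_poissonField_prod ρ _ fun i n => charlier ρ c (ξ i) n ^ 2

lemma configOf_shift {k : ℕ} (z : Lattice d) (x : Fin k → Lattice d) :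
    configOf (shift z x) = (configOf x).mapDomain (z + ·) := by
  simp [configOf, shift, Finsupp.mapDomain_finsetSum, Finsupp.mapDomain_single]

lemma dualityNormSq_shift {k : ℕ} (c : ℝ) (z : Lattice d) (x : Fin k → Lattice d) :
    dualityNormSq ρ c (configOf (shift z x)) = dualityNormSq ρ c (configOf x) := by
  rw [dualityNormSq_eq_prod, dualityNormSq_eq_prod, configOf_shift,
    Finsupp.prod_mapDomain_index_inj (add_right_injective z)]

lemma configOf_apply {k : ℕ} (x : Fin k → Lattice d) (y : Lattice d) :
    configOf x y = (Finset.univ.filter fun i => x i = y).card := by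
  classical
  simp [configOf, Finsupp.finsetSum_apply, Finsupp.single_apply, Finset.sum_boole]

lemma configOf_support_subset {k : ℕ} (x : Fin k → Lattice d) :
    (configOf x).support ⊆ Finset.univ.image x := by
  intro y hy
  rw [Finsupp.mem_support_iff, configOf_apply, Finset.card_ne_zero] at hy
  obtain ⟨i, hi⟩ := hy
  exact Finset.mem_image.2 ⟨i, Finset.mem_univ _, (Finset.mem_filter.1 hi).2⟩

/-- The degree at a site equals the number of labels sent there, so `Finset.prod_comp` distributes
the single-site bounds as one factor per label, coinciding sites included. -/
lemma abs_duality_configOf_le {k : ℕ} (c : ℝ) (x : Fin k → Lattice d) (η : Config d) :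
    |duality ρ c (configOf x) η| ≤ (|c| * (1 + 1 / ρ)) ^ k * ∏ i, (1 + (η (x i) : ℝ)) := by
  classical
  rw [duality_eq_prod ρ c _ _ (configOf_support_subset x), Finset.abs_prod]
  calc ∏ y ∈ Finset.univ.image x, |charlier ρ c (configOf x y) (η y)|
      ≤ ∏ y ∈ Finset.univ.image x, (|c| * (1 + 1 / ρ) * (1 + (η y : ℝ))) ^
          (Finset.univ.filter fun i => x i = y).card := by
        refine Finset.prod_le_prod (fun _ _ => abs_nonneg _) fun y _ => ?_
        rw [mul_pow, ← configOf_apply]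
        exact abs_charlier_le ρ c _ _
    _ = ∏ i, (|c| * (1 + 1 / ρ) * (1 + (η (x i) : ℝ))) :=
        (Finset.prod_comp (fun y => |c| * (1 + 1 / (ρ : ℝ)) * (1 + (η y : ℝ))) x).symm
    _ = _ := by rw [Finset.prod_mul_distrib]; simp

lemma measurable_duality (c : ℝ) (ξ : Lattice d →₀ ℕ) : Measurable (duality ρ c ξ) := by
  unfold duality Finsupp.prod
  exact Finset.measurable_prod _ fun i _ =>
    (Measurable.of_discrete (f := charlier ρ c (ξ i))).comp (measurable_pi_apply i)

/-- A bound for `E[∏ᵢ (1 + η(uᵢ))]` that does not depend on the sites. -/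
noncomputable def momentBound (m : ℕ) : ℝ := 1 + m * ∫ n, (1 + (n : ℝ)) ^ m ∂(poissonMeasure ρ)

lemma momentBound_nonneg (m : ℕ) : 0 ≤ momentBound ρ m := by
  unfold momentBound
  have : 0 ≤ ∫ n, (1 + (n : ℝ)) ^ m ∂(poissonMeasure ρ) := integral_nonneg fun n => by positivity
  positivity

/-- The product is at most a power of the largest factor. This reduces mixed moments to single-site
ones without asking which sites coincide; the `1` is needed only when `ι` is empty. -/
lemma prod_le_one_add_sum_pow {ι : Type*} [Fintype ι] (a : ι → ℝ) (ha : ∀ i, 0 ≤ a i) :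
    ∏ i, a i ≤ 1 + ∑ i, a i ^ Fintype.card ι := by
  rcases isEmpty_or_nonempty ι with h | h
  · simp
  · obtain ⟨j, -, hj⟩ := Finset.exists_max_image Finset.univ a Finset.univ_nonempty
    calc ∏ i, a i ≤ ∏ _i : ι, a j :=
          Finset.prod_le_prod (fun i _ => ha i) fun i hi => hj i hi
      _ = a j ^ Fintype.card ι := by simp
      _ ≤ ∑ i, a i ^ Fintype.card ι :=
          Finset.single_le_sum (f := fun i => a i ^ Fintype.card ι)
            (fun i _ => pow_nonneg (ha i) _) (Finset.mem_univ j)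
      _ ≤ _ := by linarith

lemma integrable_moment (y : Lattice d) (m : ℕ) :
    Integrable (fun η : Config d => (1 + (η y : ℝ)) ^ m) (poissonField d ρ) := by
  have := integrable_poissonField_prod (d := d) ρ {y} (f := fun _ n => (1 + (n : ℝ)) ^ m)
    fun _ _ => ((ExpBounded.const 1).add ExpBounded.natCast).pow m
  simpa using this

lemma integral_moment (y : Lattice d) (m : ℕ) :
    ∫ η, (1 + (η y : ℝ)) ^ m ∂(poissonField d ρ) =
      ∫ n, (1 + (n : ℝ)) ^ m ∂(poissonMeasure ρ) := by
  have := integral_poissonField_prod (d := d) ρ {y} (fun _ n => (1 + (n : ℝ)) ^ m)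
  simpa using this

variable {ι : Type*} [Fintype ι]

lemma integrable_prod_one_add (u : ι → Lattice d) :
    Integrable (fun η : Config d => ∏ i, (1 + (η (u i) : ℝ))) (poissonField d ρ) := by
  refine Integrable.mono' ((integrable_const (1 : ℝ)).add (integrable_finsetSum Finset.univ
    fun i _ => integrable_moment ρ (u i) (Fintype.card ι))) ?_ (Eventually.of_forall fun η => ?_)
  · refine (Finset.measurable_prod _ fun i _ => ?_).aestronglyMeasurable
    exact (Measurable.of_discrete (f := fun n : ℕ => 1 + (n : ℝ))).comp (measurable_pi_apply (u i))
  · rw [Real.norm_eq_abs, abs_of_nonneg (by positivity)]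
    simpa using prod_le_one_add_sum_pow (fun i => 1 + (η (u i) : ℝ)) fun i => by positivity

lemma integral_prod_one_add_le (u : ι → Lattice d) :
    ∫ η, ∏ i, (1 + (η (u i) : ℝ)) ∂(poissonField d ρ) ≤ momentBound ρ (Fintype.card ι) := by
  have hi : Integrable (fun η : Config d => 1 + ∑ i, (1 + (η (u i) : ℝ)) ^ Fintype.card ι)
      (poissonField d ρ) := (integrable_const (1 : ℝ)).add (integrable_finsetSum Finset.univ
    fun i _ => integrable_moment ρ (u i) (Fintype.card ι))
  refine (integral_mono (integrable_prod_one_add ρ u) hi fun η =>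
    prod_le_one_add_sum_pow (fun i => 1 + (η (u i) : ℝ)) fun i => by positivity).trans_eq ?_
  rw [integral_add (integrable_const _) (integrable_finsetSum _ fun i _ => integrable_moment ρ _ _),
    integral_finsetSum _ fun i _ => integrable_moment ρ _ _]
  simp [integral_moment, momentBound]

end Field

end IRW

/-! ### Falling factorials as counts of distinct particles. -/

namespace IRW

open scoped ENNReal

section Falling

variable {ι V L : Type*} [DecidableEq V]

/-- The product over the sites `y` of the falling factorials of `n y` whose orders are the numbers
of `i ∈ s` with `u i = y`. -/
def fallingProd (s : Finset ι) (u : ι → V) (n : V → ℕ) : ℕ :=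
  ∏ y ∈ s.image u, (n y).descFactorial (s.filter fun i => u i = y).card

lemma fallingProd_eq_prod (s : Finset ι) (u : ι → V) (n : V → ℕ) {t : Finset V}
    (h : s.image u ⊆ t) :
    fallingProd s u n = ∏ y ∈ t, (n y).descFactorial (s.filter fun i => u i = y).card := by
  refine Finset.prod_subset h fun y _ hy => ?_
  rw [Finset.filter_eq_empty_iff.2 fun i hi h => hy (Finset.mem_image.2 ⟨i, hi, h⟩)]
  simp

lemma fallingProd_coe_sort (s : Finset ι) (u : ι → V) (n : V → ℕ) :
    fallingProd Finset.univ (fun i : s => u i) n = fallingProd s u n := by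
  have h : (Finset.univ.image fun i : s => u i) = s.image u := by
    ext y; simp
  unfold fallingProd
  rw [h]
  refine Finset.prod_congr rfl fun y _ => ?_
  congr 1
  refine Finset.card_bij (fun i _ => i.1) (by simp) (fun a _ b _ h => Subtype.ext h) ?_
  intro b hb
  rw [Finset.mem_filter] at hb
  exact ⟨⟨b, hb.1⟩, by simp [hb.2], rfl⟩

lemma fallingProd_le (s : Finset ι) (u : ι → V) (n : V → ℕ) :
    fallingProd s u n ≤ ∏ i ∈ s, n (u i) := by
  rw [Finset.prod_comp]
  exact Finset.prod_le_prod' fun y _ => Nat.descFactorial_le_pow _ _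

/-- The number of injective selections of elements of disjoint sets. -/
lemma encard_injective_selections [Fintype ι] (A : V → Set L)
    (hA : ∀ y y' l, l ∈ A y → l ∈ A y' → y = y') (n : V → ℕ)
    (hn : ∀ y, (n y : ℕ∞) = (A y).encard) (u : ι → V) :
    {l : ι → L | Function.Injective l ∧ ∀ i, l i ∈ A (u i)}.encard =
      (fallingProd Finset.univ u n : ℕ) := by
  classical
  have hfin : ∀ y, (A y).Finite := fun y => Set.finite_of_encard_eq_coe (hn y).symm
  let _ : ∀ y, Fintype (A y) := fun y => (hfin y).fintype
  have hcard : ∀ y, Fintype.card (A y) = n y := fun y => by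
    have := hn y
    rw [← Set.coe_fintypeCard] at this
    exact_mod_cast this.symm
  have hinj : ∀ (g : ∀ y : (Finset.univ.image u : Finset V), {i // u i = y} ↪ A y)
      (y y' : (Finset.univ.image u : Finset V)) (i i' : ι) (hi : u i = y) (hi' : u i' = y'),
      (g y ⟨i, hi⟩ : L) = g y' ⟨i', hi'⟩ → i = i' := by
    intro g y y' i i' hi hi' h
    obtain rfl : y = y' := Subtype.ext (hA _ _ _ (g y ⟨i, hi⟩).2 (h ▸ (g y' ⟨i', hi'⟩).2))
    exact congrArg Subtype.val ((g y).injective (Subtype.ext h))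
  -- As the sets `A y` are disjoint, a selection is injective exactly when it is injective on each
  -- fibre of `u`; and the embeddings of a fibre into `A y` are counted by `descFactorial`.
  let e : {l : ι → L | Function.Injective l ∧ ∀ i, l i ∈ A (u i)} ≃
      ∀ y : (Finset.univ.image u : Finset V), {i // u i = y} ↪ A y :=
    { toFun := fun l y => ⟨fun i => ⟨l.1 i, by have := l.2.2 i; rwa [i.2] at this⟩,
        fun i j h => Subtype.ext (l.2.1 (congrArg Subtype.val h))⟩
      invFun := fun g => ⟨fun i => g ⟨u i, by simp⟩ ⟨i, rfl⟩,
        fun i j h => hinj g _ _ i j rfl rfl h, fun i => (g ⟨u i, by simp⟩ ⟨i, rfl⟩).2⟩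
      left_inv := fun l => by ext; rfl
      right_inv := fun g => by
        have key : ∀ (y : V) (hy : y ∈ Finset.univ.image u) (i : ι) (hi : u i = y),
            (g ⟨u i, by simp⟩ ⟨i, rfl⟩ : L) = g ⟨y, hy⟩ ⟨i, hi⟩ := by
          rintro y hy i rfl
          rfl
        funext y
        exact Function.Embedding.ext fun i => Subtype.ext (key y y.2 i.1 i.2) }
  rw [Set.encard, ENat.card_congr e, ENat.card_eq_coe_fintype_card, Fintype.card_pi]
  congr 1
  rw [fallingProd, ← Finset.prod_coe_sort (Finset.univ.image u)]
  refine Finset.prod_congr rfl fun y _ => ?_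
  rw [Fintype.card_embedding_eq, hcard, Fintype.card_subtype]

/-- The count written as a sum of products of indicators, a form that can be integrated term by
term. -/
lemma tsum_injective_selections [Fintype ι] (A : V → Set L)
    (hA : ∀ y y' l, l ∈ A y → l ∈ A y' → y = y') (n : V → ℕ)
    (hn : ∀ y, (n y : ℕ∞) = (A y).encard) (u : ι → V) :
    ∑' l : ι → L, {l : ι → L | Function.Injective l}.indicator 1 l *
      ∏ i, (A (u i)).indicator (1 : L → ℝ≥0∞) (l i) = (fallingProd Finset.univ u n : ℕ) := by
  classical
  have h : ∀ l : ι → L, {l : ι → L | Function.Injective l}.indicator 1 l *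
      ∏ i, (A (u i)).indicator (1 : L → ℝ≥0∞) (l i) =
      {l : ι → L | Function.Injective l ∧ ∀ i, l i ∈ A (u i)}.indicator 1 l := by
    intro l
    by_cases h1 : Function.Injective l
    · by_cases h2 : ∀ i, l i ∈ A (u i)
      · simp [h1, h2]
      · obtain ⟨i, hi⟩ := not_forall.1 h2
        rw [Finset.prod_eq_zero (Finset.mem_univ i) (by simp [hi])]
        simp [h2]
    · simp [h1]
  have h1 := tsum_subtype {l : ι → L | Function.Injective l ∧ ∀ i, l i ∈ A (u i)}
    (1 : (ι → L) → ℝ≥0∞)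
  simp only [Pi.one_apply] at h1
  rw [tsum_congr h, ← h1, ENNReal.tsum_set_one, encard_injective_selections A hA n hn u]
  simp

/-- The count at time zero, where the particles at a site are labelled by the site and a number:
with the sites `z` fixed, only the numbers are summed. -/
lemma tsum_injective_labels [Fintype ι] (z : ι → V) (n : V → ℕ) :
    ∑' m : ι → ℕ, {l : ι → V × ℕ | Function.Injective l}.indicator 1 (fun i => (z i, m i)) *
      ∏ i, {l : V × ℕ | l.2 < n l.1}.indicator (1 : V × ℕ → ℝ≥0∞) (z i, m i) =
      (fallingProd Finset.univ z n : ℕ) := by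
  classical
  have hA : ∀ y, (n y : ℕ∞) = {l : V × ℕ | l.1 = y ∧ l.2 < n l.1}.encard := by
    intro y
    have : {l : V × ℕ | l.1 = y ∧ l.2 < n l.1} = (fun m => (y, m)) '' (Finset.range (n y) : Set ℕ) := by
     
      ext ⟨a, b⟩
      simp only [Set.mem_ofPred_eq, Set.mem_image, Finset.coe_range, Set.mem_Iio, Prod.mk.injEq]
      constructor
      · rintro ⟨rfl, h⟩; exact ⟨b, h, rfl, rfl⟩
      · rintro ⟨m, h, rfl, rfl⟩; exact ⟨rfl, h⟩
    rw [this, Function.Injective.encard_image fun a b h => (Prod.mk.inj h).2,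
      Set.encard_coe_eq_coe_finsetCard, Finset.card_range]
  rw [← tsum_injective_selections (fun y => {l : V × ℕ | l.1 = y ∧ l.2 < n l.1})
    (fun y y' l h h' => h.1.symm.trans h'.1) n hA z]
  have hinj : Function.Injective fun (m : ι → ℕ) (i : ι) => (z i, m i) := fun a b h =>
    funext fun i => (Prod.mk.inj (congrFun h i)).2
  rw [← hinj.tsum_eq]
  · refine tsum_congr fun m => ?_
    congr 1
    refine Finset.prod_congr rfl fun i _ => ?_
    simp [Set.indicator_apply]
  · intro l hl
    rw [Function.mem_support] at hl
    refine ⟨fun i => (l i).2, funext fun i => Prod.ext ?_ rfl⟩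
    by_contra h
    exact hl (by
      rw [Finset.prod_eq_zero (Finset.mem_univ i), mul_zero]
      simp only [Set.indicator_apply, Set.mem_ofPred_eq, ite_eq_right_iff]
      exact fun h' => absurd h'.1.symm h)

end Falling

/-! ### Duality for factorial moments. -/

section Duality

variable {d : ℕ} {Ω : Type*} [MeasurableSpace Ω] {P : Measure Ω} [IsProbabilityMeasure P]

/-- Factorial moments at a later time, in terms of those of the initial configuration. -/
lemma lintegral_fallingProd_mul {ι : Type*} [Fintype ι] {N₀ N₁ : Ω → Config d}
    {Z : Lattice d × ℕ → Ω → Lattice d} (hN₀ : AEMeasurable N₀ P) (hZ : ∀ l, Measurable (Z l))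
    (hind : iIndepFun Z P) (hind₀ : IndepFun N₀ (fun ω l => Z l ω) P)
    {K : Lattice d → Lattice d → ℝ≥0∞} (hK : ∀ l u, P {ω | Z l ω = u} = K l.1 u)
    (hN₁ : ∀ᵐ ω ∂P, ∀ y, (N₁ ω y : ℕ∞) =
      Set.encard {l : Lattice d × ℕ | l.2 < N₀ ω l.1 ∧ Z l ω = y})
    (u : ι → Lattice d) {F : Config d → ℝ≥0∞} (hF : Measurable F) :
    ∫⁻ ω, (fallingProd Finset.univ u (N₁ ω) : ℕ) * F (N₀ ω) ∂P =
      ∑' z : ι → Lattice d, (∏ i, K (z i) (u i)) *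
        ∫⁻ ω, (fallingProd Finset.univ z (N₀ ω) : ℕ) * F (N₀ ω) ∂P := by
  classical
  -- For a tuple `l` of labels, `a` asks that the particles exist at time zero, `b` that they end at
  -- `u`, and `J` that they are distinct. The first depends on `N₀`, the second on the independent
  -- walks.
  let a : (ι → Lattice d × ℕ) → Config d → ℝ≥0∞ := fun l η =>
    ∏ i, {l : Lattice d × ℕ | l.2 < η l.1}.indicator 1 (l i)
  let b : (ι → Lattice d × ℕ) → Ω → ℝ≥0∞ := fun l ω =>
    ∏ i, ({u i} : Set (Lattice d)).indicator 1 (Z (l i) ω)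
  let J : (ι → Lattice d × ℕ) → ℝ≥0∞ := {l | Function.Injective l}.indicator 1
  have ha : ∀ l, Measurable (a l) := by
    intro l
    refine Finset.measurable_prod _ fun i _ => ?_
    have : (fun η : Config d => {l : Lattice d × ℕ | l.2 < η l.1}.indicator (1 : Lattice d × ℕ → ℝ≥0∞) (l i)) =
        (fun m : ℕ => if (l i).2 < m then 1 else 0) ∘ fun η : Config d => η (l i).1 := by
      funext η; simp [Set.indicator_apply]
    rw [this]
    exact Measurable.of_discrete.comp (measurable_pi_apply _)
  have hb1 : ∀ (l : Lattice d × ℕ) (v : Lattice d),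
      Measurable fun ω => ({v} : Set (Lattice d)).indicator (1 : Lattice d → ℝ≥0∞) (Z l ω) := fun l v =>
    (Measurable.of_discrete (f := ({v} : Set (Lattice d)).indicator
      (1 : Lattice d → ℝ≥0∞))).comp (hZ l)
  have hb : ∀ l, Measurable (b l) := fun l => Finset.measurable_prod _ fun i _ => hb1 _ _
  -- Distinctness is essential: independence factorizes the expectation only when no walk is used
  -- twice.
  have hB : ∀ l, Function.Injective l → ∫⁻ ω, b l ω ∂P = ∏ i, K (l i).1 (u i) := by
    intro l hl
    have h1 : iIndepFun (fun i ω => ({u i} : Set (Lattice d)).indicator (1 : Lattice d → ℝ≥0∞)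
        (Z (l i) ω)) P :=
      (hind.precomp hl).comp (fun i => ({u i} : Set (Lattice d)).indicator 1)
        fun i => Measurable.of_discrete
    rw [lintegral_prod_eq_prod_lintegral_of_indepFun Finset.univ _ h1 fun i => hb1 _ _]
    refine Finset.prod_congr rfl fun i _ => ?_
    rw [← hK]
    have : (fun ω => ({u i} : Set (Lattice d)).indicator (1 : Lattice d → ℝ≥0∞) (Z (l i) ω)) =
        {ω | Z (l i) ω = u i}.indicator 1 := by
      funext ω; simp [Set.indicator_apply]
    rw [this]
    exact lintegral_indicator_one (hZ _ (MeasurableSet.singleton _))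
  have haF : ∀ l, AEMeasurable (fun ω => a l (N₀ ω) * F (N₀ ω)) P := fun l =>
    ((ha l).mul hF).comp_aemeasurable hN₀
  have hm : ∀ l, AEMeasurable (fun ω => J l * (a l (N₀ ω) * F (N₀ ω))) P := fun l =>
    (haF l).const_mul _
  have hmb : ∀ l, AEMeasurable (fun ω => J l * ((a l (N₀ ω) * F (N₀ ω)) * b l ω)) P := fun l =>
    ((haF l).mul (hb l).aemeasurable).const_mul _
  have step1 : ∀ᵐ ω ∂P, ((fallingProd Finset.univ u (N₁ ω) : ℕ) : ℝ≥0∞) * F (N₀ ω) =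
      ∑' l, J l * ((a l (N₀ ω) * F (N₀ ω)) * b l ω) := by
    filter_upwards [hN₁] with ω hω
    rw [← tsum_injective_selections (fun y => {l : Lattice d × ℕ | l.2 < N₀ ω l.1 ∧ Z l ω = y})
      (fun y y' l h h' => h.2.symm.trans h'.2) (N₁ ω) hω u, ← ENNReal.tsum_mul_right]
    refine tsum_congr fun l => ?_
    have : ∏ i, {l : Lattice d × ℕ | l.2 < N₀ ω l.1 ∧ Z l ω = u i}.indicator (1 : Lattice d × ℕ → ℝ≥0∞) (l i) =
        a l (N₀ ω) * b l ω := by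
      rw [← Finset.prod_mul_distrib]
      refine Finset.prod_congr rfl fun i _ => ?_
      by_cases h1 : (l i).2 < N₀ ω (l i).1 <;> by_cases h2 : Z (l i) ω = u i <;>
        simp [h1, h2]
    rw [this]
    ring
  have step2 : ∀ l, ∫⁻ ω, J l * ((a l (N₀ ω) * F (N₀ ω)) * b l ω) ∂P =
      (∏ i, K (l i).1 (u i)) * ∫⁻ ω, J l * (a l (N₀ ω) * F (N₀ ω)) ∂P := by
    intro l
    by_cases hl : Function.Injective l
    · have hJ : J l = 1 := by simp [J, hl]
      simp only [hJ, one_mul]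
      have hi : IndepFun (fun ω => a l (N₀ ω) * F (N₀ ω)) (b l) P := by
        have h2 : Measurable fun y : Lattice d × ℕ → Lattice d =>
            ∏ i, ({u i} : Set (Lattice d)).indicator (1 : Lattice d → ℝ≥0∞) (y (l i)) :=
          Finset.measurable_prod _ fun i _ => (Measurable.of_discrete
            (f := ({u i} : Set (Lattice d)).indicator (1 : Lattice d → ℝ≥0∞))).comp
              (measurable_pi_apply (l i))
        exact hind₀.comp ((ha l).mul hF) h2
      rw [lintegral_mul_eq_lintegral_mul_lintegral_of_indepFun''
        (haF l) (hb l).aemeasurable hi, hB l hl, mul_comm]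
    · have hJ : J l = 0 := by simp [J, hl]
      simp [hJ]
  rw [lintegral_congr_ae step1, lintegral_tsum hmb,
    tsum_congr step2,
    -- Tuples of labels are split into starting sites `z` and numbers `m`. The transition weights
    -- see only `z`, and the sum over `m` rebuilds the falling factorials at time zero.
    ← (Equiv.arrowProdEquivProdArrow ι (fun _ => Lattice d) (fun _ => ℕ)).symm.tsum_eq,
    ENNReal.tsum_prod']
  refine tsum_congr fun z => ?_
  simp only [Equiv.arrowProdEquivProdArrow, Equiv.coe_fn_symm_mk]
  rw [ENNReal.tsum_mul_left, ← lintegral_tsum fun m => hm _]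
  congr 1
  refine lintegral_congr fun ω => ?_
  rw [← tsum_injective_labels z (N₀ ω), ← ENNReal.tsum_mul_right]
  exact tsum_congr fun m => (mul_assoc _ _ _).symm

end Duality

end IRW

/-! ### Expansion of the duality polynomials over subsets of labels. -/

namespace IRW

open scoped ENNReal

section Expansion

variable {d k : ℕ}

/-- Expansion of the duality polynomials into falling factorials over labeled particles. -/
lemma duality_configOf_eq_sum (ρ : ℝ≥0) (c : ℝ) (x : Fin k → Lattice d) (η : Config d) :
    duality ρ c (configOf x) η =
      c ^ k * ∑ S : Finset (Fin k), (-1 / (ρ : ℝ)) ^ S.card * (fallingProd S x η : ℕ) := by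
  classical
  set T := Finset.univ.image x with hT
  have hmem : ∀ i, x i ∈ T := fun i => Finset.mem_image_of_mem x (Finset.mem_univ i)
  let B : Lattice d → Finset (Fin k) := fun y => Finset.univ.filter fun i => x i = y
  let g : Lattice d → Finset (Fin k) → ℝ := fun y s =>
    (-1 / (ρ : ℝ)) ^ s.card * ((η y).descFactorial s.card : ℕ)
  -- The binomial coefficient in the Charlier polynomial counts the subsets of given size of the
  -- fibre of `x` over `y`.
  have h1 : ∀ y, charlier ρ c (configOf x y) (η y) =
      c ^ (B y).card * ∑ s ∈ (B y).powerset, g y s := by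
    intro y
    rw [Finset.sum_powerset_apply_card (fun j => (-1 / (ρ : ℝ)) ^ j * ((η y).descFactorial j : ℕ)),
      configOf_apply, charlier]
    congr 1
    exact Finset.sum_congr rfl fun j _ => by rw [nsmul_eq_mul, mul_assoc]
  have h2 : ∏ y ∈ T, c ^ (B y).card = c ^ k := by
    rw [← Finset.prod_comp (fun _ => c) x]; simp
  have h3 : ∀ S : Finset (Fin k), ∏ y : T, g y (S.filter fun i => x i = y) =
      (-1 / (ρ : ℝ)) ^ S.card * (fallingProd S x η : ℕ) := by
    intro S
    have hS : S.image x ⊆ T := Finset.image_subset_image (Finset.subset_univ S)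
    rw [Finset.prod_coe_sort T fun y => g y (S.filter fun i => x i = y),
      fallingProd_eq_prod S x η hS, Finset.prod_mul_distrib, Nat.cast_prod]
    congr 1
    rw [Finset.prod_pow_eq_pow_sum,
      ← Finset.card_eq_sum_card_fiberwise fun i _ => hmem i]
  rw [duality_eq_prod ρ c _ _ (configOf_support_subset x), Finset.prod_congr rfl fun y _ => h1 y,
    Finset.prod_mul_distrib, h2, ← Finset.prod_coe_sort T,
    Finset.prod_univ_sum (fun y : T => (B y).powerset) fun y s => g y s]
  congr 1
  symm
  -- A set of labels amounts to its traces on the fibres of `x`.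
  refine Finset.sum_bij' (fun S _ y => S.filter fun i => x i = y)
    (fun q _ => Finset.univ.filter fun i => i ∈ q ⟨x i, hmem i⟩) ?_ (by simp) ?_ ?_ ?_
  · intro S _
    rw [Fintype.mem_piFinset]
    exact fun y => Finset.mem_powerset.2 (Finset.filter_subset_filter _ (Finset.subset_univ S))
  · intro S _
    ext i
    simp
  · intro q hq
    rw [Fintype.mem_piFinset] at hq
    funext ⟨y, hy⟩
    ext i
    simp only [Finset.mem_filter, Finset.mem_univ, true_and]
    constructor
    · rintro ⟨h, rfl⟩
      exact h
    · intro h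
      have := Finset.mem_powerset.1 (hq ⟨y, hy⟩) h
      simp only [B, Finset.mem_filter, Finset.mem_univ, true_and] at this
      subst this
      exact ⟨h, rfl⟩
  · exact fun S _ => (h3 S).symm

end Expansion

/-! ### Real-valued duality with uniform bounds. -/

section RealDuality

variable {d : ℕ} {ρ : ℝ≥0}

/-- Measurable functions of the configuration that are bounded by `C ∏ⱼ (1 + η(wⱼ))`. -/
structure PolyBounded {J : Type*} [Fintype J] (w : J → Lattice d) (C : ℝ) (G : Config d → ℝ) :
    Prop where
  measurable : Measurable G
  bound : ∀ η, |G η| ≤ C * ∏ j, (1 + (η (w j) : ℝ))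

lemma measurable_fallingProd {ι : Type*} (s : Finset ι) (z : ι → Lattice d) :
    Measurable fun η : Config d => fallingProd s z η :=
  Finset.measurable_prod _ fun y _ => (Measurable.of_discrete
    (f := fun m : ℕ => m.descFactorial (s.filter fun i => z i = y).card)).comp
      (measurable_pi_apply y)

variable {J ι : Type*} [Fintype J] [Fintype ι] {w : J → Lattice d} {C : ℝ} {G : Config d → ℝ}

lemma PolyBounded.const_nonneg (hG : PolyBounded w C G) : 0 ≤ C := by
  -- At the empty configuration the product in the bound equals one.
  have := (abs_nonneg _).trans (hG.bound fun _ => 0)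
  simpa using this

lemma PolyBounded.falling_mul_bound (hG : PolyBounded w C G) (s : Finset ι) (z : ι → Lattice d)
    (η : Config d) : |(fallingProd s z η : ℕ) * G η| ≤
      C * ∏ i : ι ⊕ J, (1 + (η (Sum.elim z w i) : ℝ)) := by
  have hC := hG.const_nonneg
  have h1 : ((fallingProd s z η : ℕ) : ℝ) ≤ ∏ i, (1 + (η (z i) : ℝ)) := by
    calc ((fallingProd s z η : ℕ) : ℝ) ≤ ∏ i ∈ s, (η (z i) : ℝ) := by
          exact_mod_cast fallingProd_le s z η
      _ ≤ ∏ i ∈ s, (1 + (η (z i) : ℝ)) :=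
          Finset.prod_le_prod (fun _ _ => by positivity) fun i _ => by linarith
      _ ≤ ∏ i, (1 + (η (z i) : ℝ)) :=
          Finset.prod_mono_set_of_one_le (fun i => by
            have : (0 : ℝ) ≤ η (z i) := by positivity
            linarith) (Finset.subset_univ s)
  rw [abs_mul, Nat.abs_cast, Fintype.prod_sum_type]
  simp only [Sum.elim_inl, Sum.elim_inr]
  calc ((fallingProd s z η : ℕ) : ℝ) * |G η|
      ≤ (∏ i, (1 + (η (z i) : ℝ))) * (C * ∏ j, (1 + (η (w j) : ℝ))) :=
        mul_le_mul h1 (hG.bound η) (abs_nonneg _) (by positivity)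
    _ = _ := by ring

lemma PolyBounded.integrable_falling_mul (hG : PolyBounded w C G) (s : Finset ι)
    (z : ι → Lattice d) :
    Integrable (fun η => (fallingProd s z η : ℕ) * G η) (poissonField d ρ) := by
  refine Integrable.mono' ((integrable_prod_one_add ρ (Sum.elim z w)).const_mul C) ?_
    (Eventually.of_forall fun η => (Real.norm_eq_abs _).trans_le (hG.falling_mul_bound s z η))
  exact (((Measurable.of_discrete (f := fun m : ℕ => (m : ℝ))).comp
    (measurable_fallingProd s z)).mul hG.measurable).aestronglyMeasurable

lemma PolyBounded.abs_integral_falling_mul_le (hG : PolyBounded w C G) (s : Finset ι)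
    (z : ι → Lattice d) :
    |∫ η, (fallingProd s z η : ℕ) * G η ∂(poissonField d ρ)| ≤
      C * momentBound ρ (Fintype.card (ι ⊕ J)) := by
  have h := norm_integral_le_of_norm_le
    ((integrable_prod_one_add ρ (Sum.elim z w)).const_mul C)
    (Eventually.of_forall fun η => (Real.norm_eq_abs _).trans_le (hG.falling_mul_bound s z η))
  rw [Real.norm_eq_abs, integral_const_mul] at h
  exact h.trans (mul_le_mul_of_nonneg_left (integral_prod_one_add_le ρ _) hG.const_nonneg)

/-- The positions `Z` at a fixed time of independent walkers started from the configuration `N₀`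
with law `poissonField d ρ`, the resulting configuration `N₁`, and the transition law `κ`, which is
assumed to be symmetric. -/
structure Evolution {Ω : Type*} [MeasurableSpace Ω] (P : Measure Ω) (ρ : ℝ≥0)
    (κ : Lattice d → Measure (Lattice d)) (N₀ N₁ : Ω → Config d)
    (Z : Lattice d × ℕ → Ω → Lattice d) : Prop where
  law : HasLaw N₀ (poissonField d ρ) P
  measurable : ∀ l, Measurable (Z l)
  indep : iIndepFun Z P
  indep_init : IndepFun N₀ (fun ω l => Z l ω) P
  -- The arguments are reversed: the chance of going from `l.1` to `u` is written as that of going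
  -- from `u` to `l.1`. A sum over starting sites thus becomes an integral over dual walkers started
  -- from `u`.
  transition : ∀ l u, P {ω | Z l ω = u} = κ u {l.1}
  count : ∀ᵐ ω ∂P, ∀ y, (N₁ ω y : ℕ∞) =
      Set.encard {l : Lattice d × ℕ | l.2 < N₀ ω l.1 ∧ Z l ω = y}

variable {Ω : Type*} [MeasurableSpace Ω] {P : Measure Ω}
  {κ : Lattice d → Measure (Lattice d)}
  {N₀ N₁ : Ω → Config d} {Z : Lattice d × ℕ → Ω → Lattice d}

/-- Measurability of `N₁` is not assumed but follows from `count`: almost surely its values are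
countable sums of measurable indicators. -/
lemma Evolution.aemeasurable_config (h : Evolution P ρ κ N₀ N₁ Z) : AEMeasurable N₁ P := by
  classical
  rw [aemeasurable_pi_iff]
  intro y
  have hm : AEMeasurable (fun ω => ∑' l : Lattice d × ℕ,
      if l.2 < N₀ ω l.1 ∧ Z l ω = y then (1 : ℝ≥0∞) else 0) P := by
    refine AEMeasurable.tsum fun l => ?_
    exact (Measurable.of_discrete (f := fun q : ℕ × Lattice d =>
      if l.2 < q.1 ∧ q.2 = y then (1 : ℝ≥0∞) else 0)).comp_aemeasurable
        ((((measurable_pi_apply l.1).comp_aemeasurable h.law.aemeasurable)).prodMk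
          (h.measurable l).aemeasurable)
  refine (Nat.measurable_floor.comp_aemeasurable hm.ennreal_toReal).congr ?_
  filter_upwards [h.count] with ω hω
  have h1 := tsum_subtype {l : Lattice d × ℕ | l.2 < N₀ ω l.1 ∧ Z l ω = y}
    (1 : Lattice d × ℕ → ℝ≥0∞)
  simp only [Pi.one_apply] at h1
  rw [ENNReal.tsum_set_one, ← hω y] at h1
  simp only [Set.indicator_apply, Set.mem_ofPred_eq, Pi.one_apply] at h1
  simp only [Function.comp_apply, ← h1]
  simp

lemma Evolution.aemeasurable_falling_mul (h : Evolution P ρ κ N₀ N₁ Z) (u : ι → Lattice d)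
    (hG : PolyBounded w C G) :
    AEMeasurable (fun ω => ((fallingProd Finset.univ u (N₁ ω) : ℕ) : ℝ) * G (N₀ ω)) P :=
  (((Measurable.of_discrete (f := fun m : ℕ => (m : ℝ))).comp
    (measurable_fallingProd Finset.univ u)).comp_aemeasurable h.aemeasurable_config).mul
      (hG.measurable.comp_aemeasurable h.law.aemeasurable)

variable [IsProbabilityMeasure P] [∀ x, IsProbabilityMeasure (κ x)]

lemma Evolution.lintegral_falling_mul (h : Evolution P ρ κ N₀ N₁ Z) (u : ι → Lattice d)
    {F : Config d → ℝ≥0∞} (hF : Measurable F) :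
    ∫⁻ ω, (fallingProd Finset.univ u (N₁ ω) : ℕ) * F (N₀ ω) ∂P =
      ∫⁻ z, ∫⁻ η, (fallingProd Finset.univ z η : ℕ) * F η ∂(poissonField d ρ)
        ∂(Measure.pi fun i => κ (u i)) := by
  rw [lintegral_fallingProd_mul h.law.aemeasurable h.measurable h.indep h.indep_init
    (K := fun x y => κ y {x}) h.transition h.count u hF, lintegral_countable']
  refine tsum_congr fun z => ?_
  rw [Measure.pi_singleton, mul_comm]
  congr 1
  have hm : Measurable fun η : Config d => ((fallingProd Finset.univ z η : ℕ) : ℝ≥0∞) * F η :=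
    ((Measurable.of_discrete (f := fun m : ℕ => (m : ℝ≥0∞))).comp
      (measurable_fallingProd Finset.univ z)).mul hF
  rw [← h.law.map_eq, lintegral_map' (hm.aemeasurable) h.law.aemeasurable]

/-- After duality the inner integral is bounded uniformly in `z`, and the dual walkers have a
probability law; so the bound does not see `u`. -/
lemma Evolution.lintegral_falling_mul_ofReal_le (h : Evolution P ρ κ N₀ N₁ Z) (u : ι → Lattice d)
    (hG : PolyBounded w C G) :
    ∫⁻ ω, ENNReal.ofReal ((fallingProd Finset.univ u (N₁ ω) : ℕ) * |G (N₀ ω)|) ∂P ≤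
      ENNReal.ofReal (C * momentBound ρ (Fintype.card (ι ⊕ J))) := by
  have hG' : PolyBounded w C fun η => |G η| :=
    ⟨hG.measurable.abs, fun η => (abs_abs (G η)).symm ▸ hG.bound η⟩
  simp only [ENNReal.ofReal_mul (Nat.cast_nonneg _), ENNReal.ofReal_natCast]
  rw [h.lintegral_falling_mul u (F := fun η => ENNReal.ofReal |G η|) hG'.measurable.ennreal_ofReal]
  calc ∫⁻ z, ∫⁻ η, (fallingProd Finset.univ z η : ℕ) * ENNReal.ofReal |G η| ∂(poissonField d ρ)
        ∂(Measure.pi fun i => κ (u i))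
      ≤ ∫⁻ _z, ENNReal.ofReal (C * momentBound ρ (Fintype.card (ι ⊕ J)))
          ∂(Measure.pi fun i => κ (u i)) := by
        refine lintegral_mono fun z => ?_
        simp only [← ENNReal.ofReal_natCast, ← ENNReal.ofReal_mul (Nat.cast_nonneg _)]
        rw [← ofReal_integral_eq_lintegral_ofReal (hG'.integrable_falling_mul _ z)
          (Eventually.of_forall fun η => by positivity)]
        exact ENNReal.ofReal_le_ofReal ((le_abs_self _).trans
          (hG'.abs_integral_falling_mul_le Finset.univ z))
    _ = _ := by simp

lemma Evolution.integrable_falling_mul (h : Evolution P ρ κ N₀ N₁ Z) (u : ι → Lattice d)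
    (hG : PolyBounded w C G) :
    Integrable (fun ω => ((fallingProd Finset.univ u (N₁ ω) : ℕ) : ℝ) * G (N₀ ω)) P := by
  refine ⟨(h.aemeasurable_falling_mul u hG).aestronglyMeasurable, ?_⟩
  rw [hasFiniteIntegral_iff_norm]
  simp only [norm_mul, Real.norm_eq_abs, Nat.abs_cast]
  exact (h.lintegral_falling_mul_ofReal_le u hG).trans_lt ENNReal.ofReal_lt_top

lemma Evolution.integral_falling_mul_abs_le (h : Evolution P ρ κ N₀ N₁ Z) (u : ι → Lattice d)
    (hG : PolyBounded w C G) :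
    ∫ ω, (fallingProd Finset.univ u (N₁ ω) : ℕ) * |G (N₀ ω)| ∂P ≤
      C * momentBound ρ (Fintype.card (ι ⊕ J)) := by
  have h1 := h.lintegral_falling_mul_ofReal_le u hG
  have h2 := (h.integrable_falling_mul u hG).abs
  simp only [abs_mul, Nat.abs_cast] at h2
  rw [← ofReal_integral_eq_lintegral_ofReal h2 (Eventually.of_forall fun η => by positivity)] at h1
  exact (ENNReal.ofReal_le_ofReal_iff (mul_nonneg hG.const_nonneg (momentBound_nonneg ρ _))).1 h1

lemma Evolution.integral_falling_mul (h : Evolution P ρ κ N₀ N₁ Z) (u : ι → Lattice d)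
    (hG : PolyBounded w C G) :
    ∫ ω, (fallingProd Finset.univ u (N₁ ω) : ℕ) * G (N₀ ω) ∂P =
      ∫ z, ∫ η, (fallingProd Finset.univ z η : ℕ) * G η ∂(poissonField d ρ)
        ∂(Measure.pi fun i => κ (u i)) := by
  have hpos : ∀ {G : Config d → ℝ}, PolyBounded w C G → (∀ η, 0 ≤ G η) →
      ∫ ω, (fallingProd Finset.univ u (N₁ ω) : ℕ) * G (N₀ ω) ∂P =
      ∫ z, ∫ η, (fallingProd Finset.univ z η : ℕ) * G η ∂(poissonField d ρ)
        ∂(Measure.pi fun i => κ (u i)) := by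
    intro G hG h0
    rw [integral_eq_lintegral_of_nonneg_ae
      (Eventually.of_forall fun ω => mul_nonneg (Nat.cast_nonneg _) (h0 _))
      (h.aemeasurable_falling_mul u hG).aestronglyMeasurable,
      integral_eq_lintegral_of_nonneg_ae (Eventually.of_forall fun z =>
        integral_nonneg fun η => mul_nonneg (Nat.cast_nonneg _) (h0 _))
      Measurable.of_discrete.aestronglyMeasurable]
    congr 1
    have e := h.lintegral_falling_mul u (F := fun η => ENNReal.ofReal (G η))
      hG.measurable.ennreal_ofReal
    simp only [← ENNReal.ofReal_natCast, ← ENNReal.ofReal_mul (Nat.cast_nonneg _)] at e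
    rw [e]
    refine lintegral_congr fun z => ?_
    rw [ofReal_integral_eq_lintegral_ofReal (hG.integrable_falling_mul _ z)
      (Eventually.of_forall fun η => mul_nonneg (Nat.cast_nonneg _) (h0 _))]
  -- The positive and negative parts of `G` inherit its bound, and everything is linear in `G`, so
  -- the nonnegative case suffices.
  have hp : PolyBounded w C fun η => max (G η) 0 :=
    ⟨hG.measurable.max measurable_const, fun η => (abs_max_le_max_abs_abs.trans (by simp)).trans
      (hG.bound η)⟩
  have hn : PolyBounded w C fun η => max (-G η) 0 :=
    ⟨hG.measurable.neg.max measurable_const,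
      fun η => (abs_max_le_max_abs_abs.trans (by simp)).trans (hG.bound η)⟩
  have hsub : ∀ η, G η = max (G η) 0 - max (-G η) 0 := fun η => by
    rcases le_total (G η) 0 with h | h
    · rw [max_eq_right h, max_eq_left (by linarith)]; ring
    · rw [max_eq_left h, max_eq_right (by linarith)]; ring
  have hbdd : ∀ {G : Config d → ℝ}, PolyBounded w C G → Integrable (fun z : ι → Lattice d =>
      ∫ η, (fallingProd Finset.univ z η : ℕ) * G η ∂(poissonField d ρ))
        (Measure.pi fun i => κ (u i)) := fun hG =>
    Integrable.of_bound Measurable.of_discrete.aestronglyMeasurable _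
      (Eventually.of_forall fun z => hG.abs_integral_falling_mul_le Finset.univ z)
  calc ∫ ω, (fallingProd Finset.univ u (N₁ ω) : ℕ) * G (N₀ ω) ∂P
      = ∫ ω, ((fallingProd Finset.univ u (N₁ ω) : ℕ) * max (G (N₀ ω)) 0 -
          (fallingProd Finset.univ u (N₁ ω) : ℕ) * max (-G (N₀ ω)) 0) ∂P :=
        integral_congr_ae (Eventually.of_forall fun ω => by
          simp only [← mul_sub, ← hsub])
    _ = _ := by
        rw [integral_sub (h.integrable_falling_mul u hp) (h.integrable_falling_mul u hn),
          hpos hp fun η => le_max_right _ _, hpos hn fun η => le_max_right _ _,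
          ← integral_sub (hbdd hp) (hbdd hn)]
        refine integral_congr_ae (Eventually.of_forall fun z => ?_)
        simp only
        rw [← integral_sub (hp.integrable_falling_mul _ z) (hn.integrable_falling_mul _ z)]
        exact integral_congr_ae (Eventually.of_forall fun η => by
          simp only [← mul_sub, ← hsub])

end RealDuality

end IRW

/-! ### Covariance of two duality polynomials. -/

namespace IRW

open scoped ENNReal

section TwoPoint

variable {d k : ℕ} {ρ : ℝ≥0}

lemma measurePreserving_restrict_pi {ι : Type*} [Fintype ι] {X : ι → Type*}
    [∀ i, MeasurableSpace (X i)] (μ : ∀ i, Measure (X i)) [∀ i, IsProbabilityMeasure (μ i)]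
    (s : Finset ι) :
    MeasurePreserving s.restrict (Measure.pi μ) (Measure.pi fun i : s => μ i) := by
  refine ⟨by fun_prop, ?_⟩
  rw [← Measure.infinitePi_eq_pi, Measure.infinitePi_map_restrict]

lemma duality_polyBounded (c : ℝ) (x : Fin k → Lattice d) :
    PolyBounded x ((|c| * (1 + 1 / ρ)) ^ k) (duality ρ c (configOf x)) :=
  ⟨measurable_duality ρ c _, abs_duality_configOf_le ρ c x⟩

variable {Ω : Type*} [MeasurableSpace Ω] {P : Measure Ω} {κ : Lattice d → Measure (Lattice d)}
  {N₀ N₁ : Ω → Config d} {Z : Lattice d × ℕ → Ω → Lattice d}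

variable [IsProbabilityMeasure P] [∀ x, IsProbabilityMeasure (κ x)]

/-- The duality relation, integrated against a function of the initial configuration. -/
lemma Evolution.integral_duality_mul (h : Evolution P ρ κ N₀ N₁ Z) (c : ℝ)
    (x : Fin k → Lattice d) {J : Type*} [Fintype J] {w : J → Lattice d} {C : ℝ} {G : Config d → ℝ}
    (hG : PolyBounded w C G) :
    Integrable (fun ω => duality ρ c (configOf x) (N₁ ω) * G (N₀ ω)) P ∧
    ∫ ω, duality ρ c (configOf x) (N₁ ω) * G (N₀ ω) ∂P =
      ∫ y, ∫ η, duality ρ c (configOf y) η * G η ∂(poissonField d ρ)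
        ∂(Measure.pi fun i => κ (x i)) := by
  have hS : ∀ S : Finset (Fin k),
      Integrable (fun ω => (fallingProd S x (N₁ ω) : ℕ) * G (N₀ ω)) P := fun S => by
    simpa only [fallingProd_coe_sort] using h.integrable_falling_mul (fun i : S => x i) hG
  have hS' : ∀ S : Finset (Fin k), ∫ ω, (fallingProd S x (N₁ ω) : ℕ) * G (N₀ ω) ∂P =
      ∫ y, ∫ η, (fallingProd S y η : ℕ) * G η ∂(poissonField d ρ)
        ∂(Measure.pi fun i => κ (x i)) := fun S => by
    have h1 := h.integral_falling_mul (fun i : S => x i) hG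
    -- The walkers outside `S` integrate out, so all the terms of the expansion live on one space of
    -- `k` dual walkers and can be summed again.
    rw [← (measurePreserving_restrict_pi (fun i => κ (x i)) S).map_eq,
      integral_map (by fun_prop) Measurable.of_discrete.aestronglyMeasurable] at h1
    simpa only [fallingProd_coe_sort, Finset.restrict_def] using h1
  have e : ∀ (y : Fin k → Lattice d) (η : Config d) (r : ℝ), duality ρ c (configOf y) η * r =
      ∑ S : Finset (Fin k), c ^ k * (-1 / (ρ : ℝ)) ^ S.card * ((fallingProd S y η : ℕ) * r) := by
    intro y η r
    rw [duality_configOf_eq_sum, Finset.mul_sum, Finset.sum_mul]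
    exact Finset.sum_congr rfl fun S _ => by ring
  simp only [e]
  refine ⟨integrable_finsetSum _ fun S _ => (hS S).const_mul _, ?_⟩
  rw [integral_finsetSum _ fun S _ => (hS S).const_mul _]
  have hin : ∀ y : Fin k → Lattice d, ∫ η, ∑ S : Finset (Fin k), c ^ k * (-1 / (ρ : ℝ)) ^ S.card *
      ((fallingProd S y η : ℕ) * G η) ∂(poissonField d ρ) = ∑ S : Finset (Fin k),
      c ^ k * (-1 / (ρ : ℝ)) ^ S.card *
        ∫ η, (fallingProd S y η : ℕ) * G η ∂(poissonField d ρ) := fun y => by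
    rw [integral_finsetSum _ fun S _ => (hG.integrable_falling_mul S y).const_mul _]
    simp only [integral_const_mul]
  simp only [hin]
  rw [integral_finsetSum _ fun S _ => (Integrable.of_bound
    Measurable.of_discrete.aestronglyMeasurable _ (Eventually.of_forall fun y =>
      hG.abs_integral_falling_mul_le S y)).const_mul _]
  simp only [integral_const_mul, hS']

/-- A bound for `E|D(ξ(x), η(t)) D(ξ(x'), η(0))|` that does not depend on `x` and `x'`. -/
lemma Evolution.exists_integral_abs_duality_le (h : Evolution P ρ κ N₀ N₁ Z) (c : ℝ) (k k' : ℕ) :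
    ∃ C : ℝ, 0 ≤ C ∧ ∀ (x : Fin k → Lattice d) (x' : Fin k' → Lattice d),
      ∫ ω, |duality ρ c (configOf x) (N₁ ω) * duality ρ c (configOf x') (N₀ ω)| ∂P ≤ C := by
  let K : ℝ := (|c| * (1 + 1 / ρ)) ^ k'
  have hK : 0 ≤ K := by positivity
  refine ⟨∑ S : Finset (Fin k), |c ^ k * (-1 / (ρ : ℝ)) ^ S.card| *
    (K * momentBound ρ (Fintype.card (S ⊕ Fin k'))), Finset.sum_nonneg fun S _ =>
      mul_nonneg (abs_nonneg _) (mul_nonneg hK (momentBound_nonneg ρ _)), fun x x' => ?_⟩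
  have hG := duality_polyBounded (ρ := ρ) c x'
  have hS : ∀ S : Finset (Fin k), Integrable (fun ω => (fallingProd S x (N₁ ω) : ℕ) *
      |duality ρ c (configOf x') (N₀ ω)|) P := fun S => by
    have := (h.integrable_falling_mul (fun i : S => x i) hG).abs
    simpa only [fallingProd_coe_sort, abs_mul, Nat.abs_cast] using this
  calc ∫ ω, |duality ρ c (configOf x) (N₁ ω) * duality ρ c (configOf x') (N₀ ω)| ∂P
      ≤ ∫ ω, ∑ S : Finset (Fin k), |c ^ k * (-1 / (ρ : ℝ)) ^ S.card| *
          ((fallingProd S x (N₁ ω) : ℕ) * |duality ρ c (configOf x') (N₀ ω)|) ∂P := by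
        refine integral_mono ((h.integral_duality_mul c x hG).1.abs)
          (integrable_finsetSum _ fun S _ => (hS S).const_mul _) fun ω => ?_
        simp only [abs_mul (duality ρ c (configOf x) (N₁ ω))]
        rw [duality_configOf_eq_sum ρ c x, Finset.mul_sum]
        calc _ ≤ (∑ S : Finset (Fin k), |c ^ k * ((-1 / (ρ : ℝ)) ^ S.card *
              (fallingProd S x (N₁ ω) : ℕ))|) * |duality ρ c (configOf x') (N₀ ω)| :=
              mul_le_mul_of_nonneg_right (Finset.abs_sum_le_sum_abs _ _) (abs_nonneg _)
          _ = _ := by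
              rw [Finset.sum_mul]
              exact Finset.sum_congr rfl fun S _ => by
                rw [← mul_assoc (c ^ k), abs_mul, Nat.abs_cast, mul_assoc]
    _ = ∑ S : Finset (Fin k), |c ^ k * (-1 / (ρ : ℝ)) ^ S.card| *
          ∫ ω, (fallingProd S x (N₁ ω) : ℕ) * |duality ρ c (configOf x') (N₀ ω)| ∂P := by
        rw [integral_finsetSum _ fun S _ => (hS S).const_mul _]
        simp only [integral_const_mul]
    _ ≤ _ := by
        refine Finset.sum_le_sum fun S _ => mul_le_mul_of_nonneg_left ?_ (abs_nonneg _)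
        have := h.integral_falling_mul_abs_le (fun i : S => x i) hG
        simpa only [fallingProd_coe_sort] using this

lemma permuted_injective (x : Fin k → Lattice d) : Function.Injective (permuted x) := by
  intro σ τ h
  induction σ using Quotient.inductionOn with | _ σ =>
  induction τ using Quotient.inductionOn with | _ τ =>
  exact Quotient.sound fun i => congrFun h i

/-- Equal configurations mean that `x` and `y` have fibres of equal size; gluing bijections of the
fibres gives the permutation. With `permuted_injective`, `PermClass x` enumerates without repetition
the vectors with the configuration of `x`. -/
lemma configOf_eq_iff_mem_range_permuted (x y : Fin k → Lattice d) :
    configOf y = configOf x ↔ y ∈ Set.range (permuted x) := by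
  classical
  constructor
  · intro h
    have hc : ∀ v, Fintype.card {i // y i = v} = Fintype.card {i // x i = v} := fun v => by
      rw [Fintype.card_subtype, Fintype.card_subtype, ← configOf_apply, ← configOf_apply, h]
    let e : ∀ v, {i // y i = v} ≃ {i // x i = v} := fun v => Fintype.equivOfCardEq (hc v)
    let σ : Fin k ≃ Fin k := (Equiv.sigmaFiberEquiv y).symm.trans
      ((Equiv.sigmaCongrRight e).trans (Equiv.sigmaFiberEquiv x))
    refine ⟨Quotient.mk _ σ, funext fun i => ?_⟩
    exact (e (y i) ⟨i, rfl⟩).2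
  · rintro ⟨σ, rfl⟩
    induction σ using Quotient.inductionOn with | _ σ =>
    exact Equiv.sum_comp σ fun i => Finsupp.single (x i) 1

/-- The covariance of two duality polynomials at different times. -/
lemma Evolution.integral_duality_mul_duality (h : Evolution P ρ κ N₀ N₁ Z) (hρ : 0 < ρ) (c : ℝ)
    (x x' : Fin k → Lattice d) :
    ∫ ω, duality ρ c (configOf x) (N₁ ω) * duality ρ c (configOf x') (N₀ ω) ∂P =
      dualityNormSq ρ c (configOf x') *
        ∑ σ : PermClass x', ∏ i, (κ (x i)).real {permuted x' σ i} := by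
  classical
  rw [(h.integral_duality_mul c x (duality_polyBounded c x')).2]
  -- Orthogonality removes every final position `y` of the dual walkers except the rearrangements of
  -- `x'`.
  have e : ∀ y : Fin k → Lattice d, ∫ η, duality ρ c (configOf y) η * duality ρ c (configOf x') η
      ∂(poissonField d ρ) = (Set.range (permuted x')).indicator
        (fun _ => dualityNormSq ρ c (configOf x')) y := by
    intro y
    by_cases hy : configOf y = configOf x'
    · rw [Set.indicator_of_mem ((configOf_eq_iff_mem_range_permuted x' y).1 hy), hy]
      simp only [dualityNormSq, sq]
    · rw [Set.indicator_of_notMem fun h' => hy ((configOf_eq_iff_mem_range_permuted x' y).2 h'),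
        IRW.integral_duality_mul_duality ρ hρ c hy]
  simp only [e]
  rw [integral_indicator_const _ (MeasurableSet.of_discrete), smul_eq_mul, mul_comm]
  congr 1
  have hr : Set.range (permuted x') = (Finset.univ.image (permuted x') : Finset _) := by simp
  rw [hr, ← sum_measureReal_singleton, Finset.sum_image fun _ _ _ _ h => permuted_injective x' h]
  refine Finset.sum_congr rfl fun σ _ => ?_
  rw [measureReal_def, Measure.pi_singleton, ENNReal.toReal_prod]
  rfl

end TwoPoint

end IRW

/-! ### Fourier analysis of the walk. -/

namespace IRW

section Kernel

variable {d : ℕ} {p : Lattice d → Lattice d → ℝ}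

lemma IsWalkKernel.neg (hp : IsWalkKernel p) (z : Lattice d) : p 0 (-z) = p 0 z := by
  rw [hp.symm 0 z, hp.translation z 0, zero_sub]

lemma IsWalkKernel.finite_support (hp : IsWalkKernel p) : (Function.support (p 0)).Finite := by
  obtain ⟨R, hR, h⟩ := hp.finite_range
  refine (Set.finite_Icc (fun _ : Fin d => -⌈R⌉) fun _ => ⌈R⌉).subset fun z hz => ?_
  have hz' : ‖z‖ ≤ R := by
    by_contra h'
    exact hz (h 0 z (by simpa using h'))
  have hc : ∀ i, |z i| ≤ ⌈R⌉ := fun i => by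
    have h1 := (norm_le_pi_norm z i).trans hz'
    rw [Int.norm_eq_abs] at h1
    exact_mod_cast h1.trans (Int.le_ceil R)
  exact ⟨fun i => (abs_le.1 (hc i)).1, fun i => (abs_le.1 (hc i)).2⟩

/-- The support of the law of one jump. -/
noncomputable def IsWalkKernel.jumps (hp : IsWalkKernel p) : Finset (Lattice d) :=
  hp.finite_support.toFinset

lemma IsWalkKernel.notMem_jumps (hp : IsWalkKernel p) {z : Lattice d} (h : z ∉ hp.jumps) :
    p 0 z = 0 := by
  simpa [IsWalkKernel.jumps] using h

lemma IsWalkKernel.sum_jumps (hp : IsWalkKernel p) : ∑ z ∈ hp.jumps, p 0 z = 1 :=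
  ((hasSum_sum_of_ne_finset_zero fun _ h => hp.notMem_jumps h).unique (hp.sum_one 0))

/-- The jump law is invariant under `z ↦ -z`. This kills the sine terms, so the characteristic
function is real and cosines can replace complex exponentials. -/
lemma IsWalkKernel.sum_jumps_odd (hp : IsWalkKernel p) {f : Lattice d → ℝ}
    (hf : ∀ z, f (-z) = -f z) : ∑ z ∈ hp.jumps, p 0 z * f z = 0 := by
  have h : ∑ z ∈ hp.jumps, p 0 z * f z = ∑ z ∈ hp.jumps, -(p 0 z * f z) := by
    refine Finset.sum_equiv (Equiv.neg _) (fun z => ?_) fun z _ => ?_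
    · simp [IsWalkKernel.jumps, hp.neg]
    · simp [hp.neg, hf]
  rw [Finset.sum_neg_distrib] at h
  linarith

lemma stepProb_nonneg (hp : IsWalkKernel p) (n : ℕ) (i j : Lattice d) : 0 ≤ stepProb p n i j := by
  induction n generalizing j with
  | zero => simp only [stepProb]; split_ifs <;> norm_num
  | succ n ih => exact tsum_nonneg fun l => mul_nonneg (ih l) (hp.nonneg l j)

lemma stepProb_translation (hp : IsWalkKernel p) (n : ℕ) (i j : Lattice d) :
    stepProb p n i j = stepProb p n 0 (j - i) := by
  induction n generalizing j with
  | zero => simp only [stepProb, eq_comm (a := (0 : Lattice d)), sub_eq_zero, eq_comm (a := j)]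
  | succ n ih =>
    simp only [stepProb]
    rw [← (Equiv.addRight i).tsum_eq]
    refine tsum_congr fun l => ?_
    rw [ih, Equiv.coe_addRight, add_sub_cancel_right, hp.translation (l + i), hp.translation l,
      sub_sub, add_comm i l]

lemma walkProb_nonneg (hp : IsWalkKernel p) (t : ℝ≥0) (i j : Lattice d) : 0 ≤ walkProb p t i j :=
  tsum_nonneg fun n => mul_nonneg (by positivity) (stepProb_nonneg hp n i j)

lemma walkProb_translation (hp : IsWalkKernel p) (t : ℝ≥0) (i j : Lattice d) :
    walkProb p t i j = walkProb p t 0 (j - i) := by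
  simp only [walkProb]
  exact tsum_congr fun n => by rw [stepProb_translation hp]

/-- The pairing of a frequency with a lattice point. -/
def pairing (θ : Fin d → ℝ) (z : Lattice d) : ℝ := ∑ i, θ i * (z i : ℝ)

lemma pairing_add (θ : Fin d → ℝ) (z w : Lattice d) :
    pairing θ (z + w) = pairing θ z + pairing θ w := by
  simp [pairing, mul_add, Finset.sum_add_distrib]

@[simp] lemma pairing_zero (θ : Fin d → ℝ) : pairing θ 0 = 0 := by simp [pairing]

lemma pairing_neg (θ : Fin d → ℝ) (z : Lattice d) : pairing θ (-z) = -pairing θ z := by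
  simp [pairing]

lemma pairing_sub (θ : Fin d → ℝ) (z w : Lattice d) :
    pairing θ (z - w) = pairing θ z - pairing θ w := by
  rw [sub_eq_add_neg, pairing_add, pairing_neg, sub_eq_add_neg]

lemma pairing_smul (a : ℝ) (θ : Fin d → ℝ) (z : Lattice d) :
    pairing (a • θ) z = a * pairing θ z := by
  simp [pairing, Finset.mul_sum, mul_assoc]

lemma continuous_pairing (z : Lattice d) : Continuous fun θ : Fin d → ℝ => pairing θ z := by
  unfold pairing; fun_prop

/-- The characteristic function of one jump. -/
noncomputable def IsWalkKernel.charFn (hp : IsWalkKernel p) (θ : Fin d → ℝ) : ℝ :=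
  ∑ z ∈ hp.jumps, p 0 z * Real.cos (pairing θ z)

lemma IsWalkKernel.continuous_charFn (hp : IsWalkKernel p) : Continuous hp.charFn :=
  continuous_finsetSum _ fun z _ =>
    continuous_const.mul (Real.continuous_cos.comp (continuous_pairing z))

lemma IsWalkKernel.one_sub_charFn (hp : IsWalkKernel p) (θ : Fin d → ℝ) :
    1 - hp.charFn θ = ∑ z ∈ hp.jumps, p 0 z * (1 - Real.cos (pairing θ z)) := by
  simp only [mul_sub, mul_one, Finset.sum_sub_distrib, hp.sum_jumps, IsWalkKernel.charFn]

lemma IsWalkKernel.one_sub_charFn_nonneg (hp : IsWalkKernel p) (θ : Fin d → ℝ) :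
    0 ≤ 1 - hp.charFn θ := by
  rw [hp.one_sub_charFn]
  exact Finset.sum_nonneg fun z _ =>
    mul_nonneg (hp.nonneg 0 z) (by linarith [Real.cos_le_one (pairing θ z)])

lemma IsWalkKernel.abs_charFn_le (hp : IsWalkKernel p) (θ : Fin d → ℝ) : |hp.charFn θ| ≤ 1 := by
  refine (Finset.abs_sum_le_sum_abs _ _).trans ?_
  rw [← hp.sum_jumps]
  refine Finset.sum_le_sum fun z _ => ?_
  rw [abs_mul, abs_of_nonneg (hp.nonneg 0 z)]
  exact mul_le_of_le_one_right (hp.nonneg 0 z) (Real.abs_cos_le_one _)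

/-- The fundamental cell `(-π, π]^d` of the frequencies. -/
def cell (d : ℕ) : Set (Fin d → ℝ) := Set.pi Set.univ fun _ => Set.Ioc (-Real.pi) Real.pi

lemma measurableSet_cell : MeasurableSet (cell d) :=
  MeasurableSet.univ_pi fun _ => measurableSet_Ioc

lemma volume_cell_lt_top : volume (cell d) < ⊤ := by
  rw [cell, volume_pi_pi]
  exact ENNReal.prod_lt_top fun i _ => by simp

instance : IsFiniteMeasure (volume.restrict (cell d)) :=
  ⟨by rw [Measure.restrict_apply_univ]; exact volume_cell_lt_top⟩

lemma integral_Ioc_exp_int (n : ℤ) :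
    ∫ θ in Set.Ioc (-Real.pi) Real.pi, Complex.exp (θ * n * Complex.I) =
      if n = 0 then 2 * (Real.pi : ℂ) else 0 := by
  rw [← intervalIntegral.integral_of_le (by linarith [Real.pi_pos])]
  split_ifs with h
  · simp [h]; ring
  · have hc : (n * Complex.I : ℂ) ≠ 0 := by simp [h]
    have e : ∀ θ : ℝ, Complex.exp (θ * n * Complex.I) = Complex.exp ((n * Complex.I) * θ) :=
      fun θ => by ring_nf
    simp only [e]
    rw [integral_exp_mul_complex hc, div_eq_zero_iff]
    left
    rw [sub_eq_zero, Complex.exp_eq_exp_iff_exists_int]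
    -- The exponents at the endpoints `π` and `-π` differ by `n` times `2πi`.
    exact ⟨n, by push_cast; ring⟩

lemma integral_cell_cos_pairing (w : Lattice d) :
    ∫ θ in cell d, Real.cos (pairing θ w) = if w = 0 then (2 * Real.pi) ^ d else 0 := by
  have h1 : ∫ θ in cell d, Complex.exp (pairing θ w * Complex.I) =
      ∏ i, if w i = 0 then 2 * (Real.pi : ℂ) else 0 := by
    rw [cell, volume_pi, Measure.restrict_pi_pi]
    simp only [← integral_Ioc_exp_int]
    rw [← integral_fintype_prod_eq_prod (fun (i : Fin d) (θ : ℝ) =>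
      Complex.exp (θ * w i * Complex.I))]
    refine integral_congr_ae (Eventually.of_forall fun θ => ?_)
    simp only [← Complex.exp_sum, pairing]
    push_cast
    rw [Finset.sum_mul]
  have hint : Integrable (fun θ => Complex.exp (pairing θ w * Complex.I))
      (volume.restrict (cell d)) := by
    refine Integrable.of_bound (C := 1) (Continuous.aestronglyMeasurable ?_)
      (Eventually.of_forall fun θ => (Complex.norm_exp_ofReal_mul_I _).le)
    have := continuous_pairing w
    fun_prop
  have h2 := Complex.reCLM.integral_comp_comm hint
  simp only [Complex.reCLM_apply, Complex.exp_ofReal_mul_I_re] at h2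
  rw [h2, h1]
  split_ifs with h
  · subst h
    simp only [Pi.zero_apply, if_true, Finset.prod_const, Finset.card_univ, Fintype.card_fin]
    norm_cast
  · obtain ⟨i, hi⟩ := Function.ne_iff.1 h
    rw [Finset.prod_eq_zero (Finset.mem_univ i) (by simpa using hi)]
    simp

lemma IsWalkKernel.integrable_cos_mul_pow (hp : IsWalkKernel p) (n : ℕ) (w : Lattice d) :
    Integrable (fun θ => Real.cos (pairing θ w) * hp.charFn θ ^ n)
      (volume.restrict (cell d)) := by
  refine Integrable.of_bound (C := 1) (Continuous.aestronglyMeasurable ?_)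
    (Eventually.of_forall fun θ => ?_)
  · exact (Real.continuous_cos.comp (continuous_pairing w)).mul (hp.continuous_charFn.pow n)
  · rw [norm_mul, norm_pow]
    exact mul_le_one₀ (Real.abs_cos_le_one _) (by positivity)
      (pow_le_one₀ (abs_nonneg _) (hp.abs_charFn_le θ))

/-- Fourier inversion for the `n`-step transition probabilities. -/
lemma IsWalkKernel.stepProb_eq_integral (hp : IsWalkKernel p) (n : ℕ) (w : Lattice d) :
    (2 * Real.pi) ^ d * stepProb p n 0 w =
      ∫ θ in cell d, Real.cos (pairing θ w) * hp.charFn θ ^ n := by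
  induction n generalizing w with
  | zero =>
    simp only [pow_zero, mul_one, integral_cell_cos_pairing, stepProb, @eq_comm _ 0 w]
    split_ifs <;> simp
  | succ n ih =>
    have e : stepProb p (n + 1) 0 w = ∑ z ∈ hp.jumps, p 0 z * stepProb p n 0 (w - z) := by
      simp only [stepProb]
      rw [← (Equiv.subLeft w).tsum_eq]
      simp only [Equiv.subLeft_apply, hp.translation (w - _) w, sub_sub_cancel]
      rw [tsum_eq_sum (s := hp.jumps) fun z hz => by rw [hp.notMem_jumps hz, mul_zero]]
      exact Finset.sum_congr rfl fun z _ => mul_comm _ _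
    have e2 : ∀ θ, Real.cos (pairing θ w) * hp.charFn θ ^ (n + 1) =
        ∑ z ∈ hp.jumps, p 0 z * (Real.cos (pairing θ (w - z)) * hp.charFn θ ^ n) := by
      intro θ
      -- Without the sine part, convolution with the jump law is multiplication by `charFn`.
      have h0 := hp.sum_jumps_odd (f := fun z => Real.sin (pairing θ z)) fun z => by
        rw [pairing_neg, Real.sin_neg]
      have h1 : ∑ z ∈ hp.jumps, p 0 z * Real.cos (pairing θ (w - z)) =
          Real.cos (pairing θ w) * hp.charFn θ := by
        simp only [pairing_sub, Real.cos_sub, mul_add, Finset.sum_add_distrib]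
        rw [show ∑ z ∈ hp.jumps, p 0 z * (Real.sin (pairing θ w) * Real.sin (pairing θ z)) =
          Real.sin (pairing θ w) * ∑ z ∈ hp.jumps, p 0 z * Real.sin (pairing θ z) by
            rw [Finset.mul_sum]; exact Finset.sum_congr rfl fun z _ => by ring, h0, mul_zero,
          add_zero, IsWalkKernel.charFn, Finset.mul_sum]
        exact Finset.sum_congr rfl fun z _ => by ring
      simp only [← mul_assoc, ← Finset.sum_mul]
      rw [h1]
      ring
    simp only [e2]
    rw [integral_finsetSum _ fun z _ => (hp.integrable_cos_mul_pow n _).const_mul _]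
    simp only [integral_const_mul, ← ih, e, Finset.mul_sum]
    exact Finset.sum_congr rfl fun z _ => by ring

/-- Fourier inversion for the continuous time transition probabilities. -/
lemma IsWalkKernel.walkProb_eq_integral (hp : IsWalkKernel p) (t : ℝ≥0) (w : Lattice d) :
    (2 * Real.pi) ^ d * walkProb p t 0 w =
      ∫ θ in cell d, Real.cos (pairing θ w) * Real.exp (-(t * (1 - hp.charFn θ))) := by
  have hF : ∀ n : ℕ, Integrable (fun θ => Real.exp (-(t : ℝ)) * (t : ℝ) ^ n / (n.factorial : ℝ) *
      (Real.cos (pairing θ w) * hp.charFn θ ^ n)) (volume.restrict (cell d)) := fun n =>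
    (hp.integrable_cos_mul_pow n w).const_mul _
  have hs : Summable fun n : ℕ => Real.exp (-(t : ℝ)) * (t : ℝ) ^ n / (n.factorial : ℝ) :=
    (hasSum_one_poissonMeasure t).summable
  have hsum : Summable fun n : ℕ => ∫ θ in cell d, ‖Real.exp (-(t : ℝ)) * (t : ℝ) ^ n /
      (n.factorial : ℝ) * (Real.cos (pairing θ w) * hp.charFn θ ^ n)‖ := by
    refine Summable.of_nonneg_of_le (fun n => integral_nonneg fun θ => norm_nonneg _)
      (fun n => ?_) (hs.mul_right (volume.real (cell d)))
    calc _ ≤ ∫ _θ in cell d, Real.exp (-(t : ℝ)) * (t : ℝ) ^ n / (n.factorial : ℝ) := by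
          refine integral_mono (hF n).norm (integrable_const _) fun θ => ?_
          simp only [norm_mul, norm_pow]
          rw [Real.norm_of_nonneg (by positivity)]
          exact mul_le_of_le_one_right (by positivity) (mul_le_one₀ (Real.abs_cos_le_one _)
            (by positivity) (pow_le_one₀ (abs_nonneg _) (hp.abs_charFn_le θ)))
      _ = _ := by rw [setIntegral_const, smul_eq_mul, mul_comm]
  have h := hasSum_integral_of_summable_integral_norm hF hsum
  rw [walkProb, ← tsum_mul_left]
  have e1 : ∀ n : ℕ, (2 * Real.pi) ^ d * (Real.exp (-(t : ℝ)) * (t : ℝ) ^ n / (n.factorial : ℝ) *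
      stepProb p n 0 w) = ∫ θ in cell d, Real.exp (-(t : ℝ)) * (t : ℝ) ^ n / (n.factorial : ℝ) *
      (Real.cos (pairing θ w) * hp.charFn θ ^ n) := fun n => by
    rw [integral_const_mul, ← hp.stepProb_eq_integral]; ring
  rw [tsum_congr e1, h.tsum_eq]
  refine integral_congr_ae (Eventually.of_forall fun θ => ?_)
  -- Averaging `charFn θ ^ n` over a Poisson number of jumps sums to an exponential.
  have h2 := (NormedSpace.expSeries_div_hasSum_exp ((t : ℝ) * hp.charFn θ)).mul_left
    (Real.exp (-(t : ℝ)) * Real.cos (pairing θ w))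
  rw [← Real.exp_eq_exp_ℝ] at h2
  have e3 : ∀ n : ℕ, Real.exp (-(t : ℝ)) * (t : ℝ) ^ n / (n.factorial : ℝ) *
      (Real.cos (pairing θ w) * hp.charFn θ ^ n) = Real.exp (-(t : ℝ)) * Real.cos (pairing θ w) *
      (((t : ℝ) * hp.charFn θ) ^ n / n.factorial) := fun n => by rw [mul_pow]; ring
  simp only [e3, h2.tsum_eq]
  rw [show -((t : ℝ) * (1 - hp.charFn θ)) = -(t : ℝ) + t * hp.charFn θ by ring, Real.exp_add]
  ring

lemma IsWalkKernel.walkProb_neg (hp : IsWalkKernel p) (t : ℝ≥0) (w : Lattice d) :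
    walkProb p t 0 (-w) = walkProb p t 0 w := by
  have h1 := hp.walkProb_eq_integral t w
  have h2 := hp.walkProb_eq_integral t (-w)
  simp only [pairing_neg, Real.cos_neg] at h2
  have h0 : ((2 * Real.pi) ^ d : ℝ) ≠ 0 := by have := Real.pi_pos; positivity
  exact mul_left_cancel₀ h0 (h2.trans h1.symm)

lemma IsWalkKernel.walkProb_symm (hp : IsWalkKernel p) (t : ℝ≥0) (i j : Lattice d) :
    walkProb p t i j = walkProb p t j i := by
  rw [walkProb_translation hp, walkProb_translation hp t j i, ← neg_sub, hp.walkProb_neg]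

/-- With half angles this is `sin² (x + y) ≤ 2 sin² x + 2 sin² y`. It plays the role of a triangle
inequality along lattice paths. -/
lemma one_sub_cos_add_le (a b : ℝ) :
    1 - Real.cos (a + b) ≤ 2 * (1 - Real.cos a) + 2 * (1 - Real.cos b) := by
  have h : ∀ x : ℝ, 1 - Real.cos x = 2 * Real.sin (x / 2) ^ 2 := fun x => by
    have := Real.cos_sq' (x / 2)
    have h2 := Real.cos_two_mul (x / 2)
    rw [mul_div_cancel₀ x two_ne_zero] at h2
    linarith
  have h1 := Real.sin_sq_add_cos_sq (a / 2)
  have h2 := Real.sin_sq_add_cos_sq (b / 2)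
  rw [h, h, h, add_div, Real.sin_add]
  set s := Real.sin (a / 2)
  set c := Real.cos (a / 2)
  set s' := Real.sin (b / 2)
  set c' := Real.cos (b / 2)
  have hs : s ^ 2 * c' ^ 2 ≤ s ^ 2 := mul_le_of_le_one_right (sq_nonneg _) (by nlinarith)
  have hs' : s' ^ 2 * c ^ 2 ≤ s' ^ 2 := mul_le_of_le_one_right (sq_nonneg _) (by nlinarith)
  nlinarith [sq_nonneg (s * c' - c * s')]

/-- Irreducibility enters here: `w` is reached from `0` by jumps of positive probability, and `1 -
cos` of each jump is at most a multiple of `1 - charFn`, being one term of that sum. -/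
lemma IsWalkKernel.exists_one_sub_cos_le (hp : IsWalkKernel p) (w : Lattice d) :
    ∃ C : ℝ, 0 ≤ C ∧ ∀ θ, 1 - Real.cos (pairing θ w) ≤ C * (1 - hp.charFn θ) := by
  induction hp.irreducible 0 w with
  | refl => exact ⟨0, le_rfl, fun θ => by simp⟩
  | @tail v w _ hvw ih =>
    obtain ⟨C, hC, h⟩ := ih
    rw [hp.translation] at hvw
    refine ⟨2 * C + 2 * (1 / p 0 (w - v)), by positivity, fun θ => ?_⟩
    have hmem : w - v ∈ hp.jumps := by
      by_contra h'
      exact hvw.ne' (hp.notMem_jumps h')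
    have h1 : p 0 (w - v) * (1 - Real.cos (pairing θ (w - v))) ≤ 1 - hp.charFn θ := by
      rw [hp.one_sub_charFn]
      exact Finset.single_le_sum (f := fun z => p 0 z * (1 - Real.cos (pairing θ z)))
        (fun z _ => mul_nonneg (hp.nonneg 0 z) (by linarith [Real.cos_le_one (pairing θ z)])) hmem
    have h2 : 1 - Real.cos (pairing θ (w - v)) ≤ 1 / p 0 (w - v) * (1 - hp.charFn θ) := by
      rw [one_div, ← div_eq_inv_mul, le_div_iff₀ hvw, mul_comm]
      exact h1
    have h3 := one_sub_cos_add_le (pairing θ v) (pairing θ (w - v))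
    rw [← pairing_add, add_sub_cancel] at h3
    linarith [h θ]

/-- Irreducibility gives a quadratic lower bound for `1 - charFn` on the fundamental cell. -/
lemma IsWalkKernel.exists_quadratic_le (hp : IsWalkKernel p) :
    ∃ κ : ℝ, 0 < κ ∧ ∀ θ ∈ cell d, κ * ∑ i, θ i ^ 2 ≤ 1 - hp.charFn θ := by
  -- The unit vectors isolate the coordinates of `θ`, and `1 - cos θᵢ ≥ (2 / π²) θᵢ²` for `|θᵢ| ≤
  -- π`.
  choose C hC h using fun i : Fin d => hp.exists_one_sub_cos_le (Pi.single i 1)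
  have hpi := Real.pi_pos
  have hS : 0 ≤ ∑ i, C i := Finset.sum_nonneg fun i _ => hC i
  refine ⟨2 / Real.pi ^ 2 / (1 + ∑ i, C i), by positivity, fun θ hθ => ?_⟩
  have h1 : ∀ i, 2 / Real.pi ^ 2 * θ i ^ 2 ≤ C i * (1 - hp.charFn θ) := by
    intro i
    have hi := hθ i (Set.mem_univ i)
    have h2 := Real.cos_le_one_sub_mul_cos_sq (x := θ i) (abs_le.2 ⟨hi.1.le, hi.2⟩)
    have h3 := h i θ
    have e : pairing θ (Pi.single i 1) = θ i := by
      rw [pairing, Finset.sum_eq_single i] <;> simp +contextual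
    rw [e] at h3
    linarith
  have h4 := Finset.sum_le_sum fun i (_ : i ∈ Finset.univ) => h1 i
  rw [← Finset.mul_sum, ← Finset.sum_mul] at h4
  rw [div_mul_eq_mul_div, div_le_iff₀ (by positivity)]
  nlinarith [hp.one_sub_charFn_nonneg θ]

end Kernel

end IRW

/-! ### Gaussian Fourier integrals. -/

namespace IRW

section Gaussian

variable {d : ℕ}

lemma integral_cos_mul_exp_neg_sq {s : ℝ} (hs : 0 < s) (a : Fin d → ℝ) :
    ∫ u : Fin d → ℝ, Real.cos (∑ i, u i * a i) * Real.exp (-(s / 2 * ∑ i, u i ^ 2)) =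
      (2 * Real.pi / s) ^ ((d : ℝ) / 2) * Real.exp (-(∑ i, a i ^ 2) / (2 * s)) := by
  have hb : 0 < ((s / 2 : ℝ) : ℂ).re := by rw [Complex.ofReal_re]; positivity
  have h1 := GaussianFourier.integral_cexp_neg_mul_sum_add hb fun i => Complex.I * (a i : ℂ)
  have hi := GaussianFourier.integrable_cexp_neg_mul_sum_add hb fun i => Complex.I * (a i : ℂ)
  have e : ∀ u : Fin d → ℝ, Complex.exp (-((s / 2 : ℝ) : ℂ) * ∑ i, (u i : ℂ) ^ 2 +
      ∑ i, Complex.I * (a i : ℂ) * u i) =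
      Complex.exp ((-(s / 2 * ∑ i, u i ^ 2) : ℝ) + ((∑ i, u i * a i : ℝ) : ℂ) * Complex.I) := by
    intro u
    congr 1
    push_cast
    rw [Finset.sum_mul]
    congr 1
    · ring
    · exact Finset.sum_congr rfl fun i _ => by ring
  have h2 := Complex.reCLM.integral_comp_comm hi
  rw [h1] at h2
  simp only [e, Complex.reCLM_apply, Complex.exp_re, Complex.add_re, Complex.add_im,
    Complex.ofReal_re, Complex.ofReal_im, Complex.re_ofReal_mul, Complex.im_ofReal_mul,
    Complex.I_re, Complex.I_im, mul_zero, mul_one, add_zero, zero_add] at h2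
  rw [integral_congr_ae (Eventually.of_forall fun u => mul_comm _ _), h2]
  have e2 : ((Real.pi : ℂ) / ((s / 2 : ℝ) : ℂ)) ^ ((Fintype.card (Fin d) : ℂ) / 2) =
      (((2 * Real.pi / s) ^ ((d : ℝ) / 2) : ℝ) : ℂ) := by
    rw [Complex.ofReal_cpow (by have := Real.pi_pos; positivity), Fintype.card_fin]
    congr 1
    · push_cast; field_simp
    · push_cast; rfl
  have e3 : (∑ i, (Complex.I * (a i : ℂ)) ^ 2) / (4 * ((s / 2 : ℝ) : ℂ)) =
      ((-(∑ i, a i ^ 2) / (2 * s) : ℝ) : ℂ) := by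
    simp only [mul_pow, Complex.I_sq]
    push_cast
    rw [← Finset.mul_sum]
    congr 1 <;> ring
  rw [e2, e3, ← Complex.ofReal_exp, ← Complex.ofReal_mul, Complex.ofReal_re]

lemma exists_eq_transpose_mul_self {Γ : Matrix (Fin d) (Fin d) ℝ} (hΓ : Γ.PosDef) :
    ∃ B : Matrix (Fin d) (Fin d) ℝ, Γ = B.transpose * B := by
  open scoped MatrixOrder in
  refine ⟨CFC.sqrt Γ, ?_⟩
  have h1 : (CFC.sqrt Γ).IsHermitian := (Matrix.nonneg_iff_posSemidef.1 (CFC.sqrt_nonneg Γ)).1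
  have h2 := CFC.sqrt_mul_sqrt_self Γ (Matrix.nonneg_iff_posSemidef.2 hΓ.posSemidef)
  rw [Matrix.IsHermitian, Matrix.conjTranspose_eq_transpose_of_trivial] at h1
  rw [h1, h2]

/-- The Fourier transform of a centered Gaussian density with covariance `(s Γ)⁻¹`. -/
lemma integral_cos_mul_exp_neg_quadratic {s : ℝ} (hs : 0 < s) {Γ : Matrix (Fin d) (Fin d) ℝ}
    (hΓ : Γ.PosDef) (v : Fin d → ℝ) :
    ∫ θ : Fin d → ℝ, Real.cos (∑ i, θ i * v i) *
        Real.exp (-(s / 2 * dotProduct θ (Γ.mulVec θ))) =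
      (2 * Real.pi) ^ d * (Γ.det ^ (-(1 : ℝ) / 2) * (2 * Real.pi * s) ^ (-(d : ℝ) / 2)) *
        Real.exp (-(dotProduct v (Γ⁻¹.mulVec v)) / (2 * s)) := by
  obtain ⟨B, hB⟩ := exists_eq_transpose_mul_self hΓ
  have hdet : Γ.det = B.det ^ 2 := by rw [hB, Matrix.det_mul, Matrix.det_transpose, sq]
  have hB0 : B.det ≠ 0 := fun h => hΓ.det_pos.ne' (by rw [hdet, h]; ring)
  have hBu : IsUnit B.det := isUnit_iff_ne_zero.2 hB0
  set a : Fin d → ℝ := (B⁻¹).transpose.mulVec v with ha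
  -- The substitution `u = Bθ` diagonalizes the quadratic form; its Jacobian `|det B|⁻¹` is `(det
  -- Γ)^(-1/2)`.
  have hmap := Real.map_matrix_volume_pi_eq_smul_volume_pi hB0
  let f : (Fin d → ℝ) → ℝ := fun u =>
    Real.cos (∑ i, u i * a i) * Real.exp (-(s / 2 * ∑ i, u i ^ 2))
  have hf : Continuous f := by fun_prop
  have h1 : ∀ θ : Fin d → ℝ, Real.cos (∑ i, θ i * v i) *
      Real.exp (-(s / 2 * dotProduct θ (Γ.mulVec θ))) = f (Matrix.toLin' B θ) := by
    intro θ
    have e1 : ∑ i, Matrix.toLin' B θ i * a i = ∑ i, θ i * v i := by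
      change dotProduct (B.mulVec θ) ((B⁻¹).transpose.mulVec v) = dotProduct θ v
      rw [Matrix.mulVec_transpose, dotProduct_comm, ← Matrix.dotProduct_mulVec, Matrix.mulVec_mulVec,
        Matrix.nonsing_inv_mul _ hBu, Matrix.one_mulVec, dotProduct_comm]
    have e2 : ∑ i, Matrix.toLin' B θ i ^ 2 = dotProduct θ (Γ.mulVec θ) := by
      simp only [sq]
      change dotProduct (B.mulVec θ) (B.mulVec θ) = _
      rw [hB, ← Matrix.mulVec_mulVec, Matrix.dotProduct_mulVec θ, Matrix.vecMul_transpose]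
    simp only [f, e1, e2]
  have h2 : dotProduct v (Γ⁻¹.mulVec v) = ∑ i, a i ^ 2 := by
    simp only [sq]
    change _ = dotProduct a a
    rw [hB, Matrix.mul_inv_rev, ← Matrix.mulVec_mulVec, Matrix.dotProduct_mulVec v, ha,
      ← Matrix.mulVec_transpose, Matrix.transpose_nonsing_inv, ← Matrix.transpose_nonsing_inv]
  have h3 : ∫ θ, f (Matrix.toLin' B θ) = |B.det|⁻¹ * ∫ u, f u := by
    rw [← integral_map (μ := volume) (φ := Matrix.toLin' B)
      (LinearMap.continuous_of_finiteDimensional _).aemeasurable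
      hf.aestronglyMeasurable, hmap, integral_smul_measure,
      ENNReal.toReal_ofReal (abs_nonneg _), abs_inv, smul_eq_mul]
  have hpi := Real.pi_pos
  simp only [h1]
  rw [h3, integral_cos_mul_exp_neg_sq hs, h2, ← mul_assoc]
  congr 1
  have e1 : Γ.det ^ (-(1 : ℝ) / 2) = |B.det|⁻¹ := by
    rw [hdet, ← sq_abs, ← Real.rpow_natCast, ← Real.rpow_mul (abs_nonneg _)]
    norm_num
    exact Real.rpow_neg_one _
  have e2 : (2 * Real.pi / s) ^ ((d : ℝ) / 2) =
      (2 * Real.pi) ^ d * (2 * Real.pi * s) ^ (-(d : ℝ) / 2) := by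
    have e3 : 2 * Real.pi / s = (2 * Real.pi) ^ (2 : ℝ) * (2 * Real.pi * s)⁻¹ := by
      rw [Real.rpow_two]; field_simp
    rw [e3, Real.mul_rpow (by positivity) (by positivity), ← Real.rpow_mul (by positivity),
      Real.inv_rpow (by positivity), ← Real.rpow_neg (by positivity),
      mul_div_cancel₀ _ two_ne_zero, Real.rpow_natCast, neg_div]
  rw [e1, e2]
  ring

end Gaussian

/-! ### The local central limit theorem. -/

section LocalLimit

variable {d : ℕ} {p : Lattice d → Lattice d → ℝ}

/-- The half-angle formula turns the expression into `sinc²`, whose continuity at `0` replaces a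
Taylor estimate. -/
lemma tendsto_sq_mul_one_sub_cos (a : ℝ) :
    Tendsto (fun N : ℕ => (N : ℝ) ^ 2 * (1 - Real.cos ((N : ℝ)⁻¹ * a))) atTop
      (𝓝 (a ^ 2 / 2)) := by
  have h1 : Tendsto (fun N : ℕ => a ^ 2 / 2 * Real.sinc ((N : ℝ)⁻¹ * (a / 2)) ^ 2) atTop
      (𝓝 (a ^ 2 / 2)) := by
    have h : Tendsto (fun N : ℕ => (N : ℝ)⁻¹ * (a / 2)) atTop (𝓝 0) := by
      simpa using tendsto_inv_atTop_nhds_zero_nat.mul_const (a / 2)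
    have := ((Real.continuous_sinc.tendsto 0).comp h).pow 2
    simpa using this.const_mul (a ^ 2 / 2)
  refine h1.congr' ((eventually_gt_atTop 0).mono fun N hN => ?_)
  have hN' : (N : ℝ) ≠ 0 := by positivity
  have hcos : 1 - Real.cos ((N : ℝ)⁻¹ * a) = 2 * Real.sin ((N : ℝ)⁻¹ * (a / 2)) ^ 2 := by
    have := Real.cos_sq' ((N : ℝ)⁻¹ * (a / 2))
    have h2 := Real.cos_two_mul ((N : ℝ)⁻¹ * (a / 2))
    rw [show 2 * ((N : ℝ)⁻¹ * (a / 2)) = (N : ℝ)⁻¹ * a by ring] at h2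
    linarith
  simp only [hcos]
  rcases eq_or_ne a 0 with rfl | ha
  · simp
  · rw [Real.sinc_of_ne_zero (by positivity)]
    field_simp

lemma IsWalkKernel.dotProduct_jumpCov (hp : IsWalkKernel p) (θ : Fin d → ℝ) :
    dotProduct θ ((jumpCov p).mulVec θ) = ∑ z ∈ hp.jumps, p 0 z * pairing θ z ^ 2 := by
  have h : ∀ i j, jumpCov p i j = ∑ z ∈ hp.jumps, p 0 z * (z i : ℝ) * (z j : ℝ) := fun i j => by
    rw [jumpCov, Matrix.of_apply, tsum_eq_sum fun z hz => by rw [hp.notMem_jumps hz]; ring]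
  simp only [dotProduct, Matrix.mulVec, h, pairing, sq, Finset.mul_sum, Finset.sum_mul]
  rw [Finset.sum_congr rfl fun i _ => Finset.sum_comm, Finset.sum_comm]
  refine Finset.sum_congr rfl fun z _ => ?_
  rw [Finset.sum_comm]
  exact Finset.sum_congr rfl fun i _ => Finset.sum_congr rfl fun j _ => by ring

lemma IsWalkKernel.tendsto_sq_mul_one_sub_charFn (hp : IsWalkKernel p) (θ : Fin d → ℝ) :
    Tendsto (fun N : ℕ => (N : ℝ) ^ 2 * (1 - hp.charFn ((N : ℝ)⁻¹ • θ))) atTop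
      (𝓝 (dotProduct θ ((jumpCov p).mulVec θ) / 2)) := by
  rw [hp.dotProduct_jumpCov, Finset.sum_div]
  simp only [hp.one_sub_charFn, Finset.mul_sum, pairing_smul]
  refine tendsto_finsetSum _ fun z _ => ?_
  have := (tendsto_sq_mul_one_sub_cos (pairing θ z)).const_mul (p 0 z)
  simpa only [mul_left_comm, mul_div_assoc] using this

lemma eventually_smul_mem_cell (θ : Fin d → ℝ) :
    ∀ᶠ N : ℕ in atTop, (N : ℝ)⁻¹ • θ ∈ cell d := by
  have h : Tendsto (fun N : ℕ => (N : ℝ)⁻¹ • θ) atTop (𝓝 0) := by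
    simpa using (tendsto_inv_atTop_nhds_zero_nat (𝕜 := ℝ)).smul_const θ
  refine h.eventually (set_pi_mem_nhds Set.finite_univ fun i _ => ?_)
  exact Ioc_mem_nhds (by simp [Real.pi_pos]) (by simp [Real.pi_pos])

/-- The quadratic lower bound on the cell is homogeneous of degree two, so it survives the rescaling
by `N` and passes to the limiting form. -/
lemma IsWalkKernel.posDef_jumpCov (hp : IsWalkKernel p) : (jumpCov p).PosDef := by
  refine Matrix.PosDef.of_dotProduct_mulVec_pos ?_ fun θ hθ => ?_
  · ext i j
    simp only [Matrix.conjTranspose_apply, star_trivial, jumpCov, Matrix.of_apply]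
    exact tsum_congr fun z => by ring
  · obtain ⟨κ, hκ, h⟩ := hp.exists_quadratic_le
    have h1 : κ * ∑ i, θ i ^ 2 ≤ dotProduct θ ((jumpCov p).mulVec θ) / 2 := by
      refine ge_of_tendsto (hp.tendsto_sq_mul_one_sub_charFn θ) ?_
      filter_upwards [eventually_smul_mem_cell θ, eventually_gt_atTop 0] with N hN hN0
      have hN' : (N : ℝ) ≠ 0 := by positivity
      have h2 := mul_le_mul_of_nonneg_left (h _ hN) (sq_nonneg (N : ℝ))
      refine le_trans (le_of_eq ?_) h2
      simp only [Pi.smul_apply, smul_eq_mul, mul_pow, ← Finset.mul_sum]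
      field_simp
    obtain ⟨i, hi⟩ := Function.ne_iff.1 hθ
    have h2 : 0 < ∑ i, θ i ^ 2 :=
      Finset.sum_pos' (fun j _ => sq_nonneg _) ⟨i, Finset.mem_univ i, by
        have : θ i ≠ 0 := hi
        positivity⟩
    rw [star_trivial]
    nlinarith

/-- The transition density of the Brownian motion with covariance `Γ`. -/
noncomputable def heatKernel (Γ : Matrix (Fin d) (Fin d) ℝ) (s : ℝ) (v : Fin d → ℝ) : ℝ :=
  Γ.det ^ (-(1 : ℝ) / 2) * (2 * Real.pi * s) ^ (-(d : ℝ) / 2) *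
    Real.exp (-(dotProduct v (Γ⁻¹.mulVec v)) / (2 * s))

/-- The rescaled integrand in the Fourier representation of the transition probabilities. -/
noncomputable def IsWalkKernel.scaledIntegrand (hp : IsWalkKernel p) (s : ℝ) (N : ℕ)
    (θ : Fin d → ℝ) : ℝ :=
  (cell d).indicator 1 ((N : ℝ)⁻¹ • θ) *
    Real.exp (-(s * ((N : ℝ) ^ 2 * (1 - hp.charFn ((N : ℝ)⁻¹ • θ)))))

/-- The factor `N ^ d` is the Jacobian of `θ ↦ θ / N`; the domain of integration becomes an
indicator inside `scaledIntegrand`. -/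
lemma IsWalkKernel.pow_mul_walkProb (hp : IsWalkKernel p) (s : ℝ≥0) {N : ℕ} (hN : 0 < N)
    (w : Lattice d) :
    (2 * Real.pi) ^ d * ((N : ℝ) ^ d * walkProb p ((N : ℝ≥0) ^ 2 * s) 0 w) =
      ∫ θ, Real.cos (∑ i, θ i * ((w i : ℝ) / N)) * hp.scaledIntegrand s N θ := by
  have h := Measure.integral_comp_inv_smul_of_nonneg (μ := (volume : Measure (Fin d → ℝ)))
    (f := (cell d).indicator fun θ => Real.cos (pairing θ w) *
      Real.exp (-(((N : ℝ) ^ 2 * s) * (1 - hp.charFn θ)))) (R := N) (by positivity)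
  rw [integral_indicator measurableSet_cell, Module.finrank_fin_fun, smul_eq_mul] at h
  have h2 := hp.walkProb_eq_integral ((N : ℝ≥0) ^ 2 * s) w
  push_cast at h2
  rw [← h2] at h
  rw [mul_left_comm, ← h]
  refine integral_congr_ae (Eventually.of_forall fun θ => ?_)
  have e : ∑ i, θ i * ((w i : ℝ) / N) = pairing ((N : ℝ)⁻¹ • θ) w := by
    rw [pairing_smul, pairing, Finset.mul_sum]
    exact Finset.sum_congr rfl fun i _ => by ring
  simp only [IsWalkKernel.scaledIntegrand, e]
  by_cases hc : (N : ℝ)⁻¹ • θ ∈ cell d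
  · simp only [hc, Set.indicator_of_mem, Pi.one_apply, one_mul]
    congr 3
    ring
  · simp [hc]

/-- The factors `N²` and `N⁻²` cancel in the quadratic lower bound, which leaves a Gaussian free of
`N`. It serves both the uniform bound on the transition probabilities and dominated convergence. -/
lemma IsWalkKernel.exists_scaledIntegrand_le (hp : IsWalkKernel p) {s : ℝ} (hs : 0 < s) :
    ∃ g : (Fin d → ℝ) → ℝ, Integrable g ∧ ∀ N : ℕ, 0 < N → ∀ θ,
      |hp.scaledIntegrand s N θ| ≤ g θ := by
  obtain ⟨κ, hκ, h⟩ := hp.exists_quadratic_le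
  refine ⟨fun θ => ∏ i, Real.exp (-(s * κ) * θ i ^ 2),
    Integrable.fintype_prod fun _ => integrable_exp_neg_mul_sq (by positivity),
    fun N hN θ => ?_⟩
  have hN' : (N : ℝ) ≠ 0 := by positivity
  simp only [← Real.exp_sum, ← Finset.mul_sum, IsWalkKernel.scaledIntegrand]
  by_cases hc : (N : ℝ)⁻¹ • θ ∈ cell d
  · simp only [hc, Set.indicator_of_mem, Pi.one_apply, one_mul, Real.abs_exp]
    refine Real.exp_le_exp.2 ?_
    have h2 := mul_le_mul_of_nonneg_left (h _ hc) (sq_nonneg (N : ℝ))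
    have e : (N : ℝ) ^ 2 * (κ * ∑ i, ((N : ℝ)⁻¹ • θ) i ^ 2) = κ * ∑ i, θ i ^ 2 := by
      simp only [Pi.smul_apply, smul_eq_mul, mul_pow, ← Finset.mul_sum]
      field_simp
    rw [e] at h2
    nlinarith
  · simp only [hc, not_false_eq_true, Set.indicator_of_notMem, zero_mul, abs_zero]
    positivity

lemma IsWalkKernel.measurable_scaledIntegrand (hp : IsWalkKernel p) (s : ℝ) (N : ℕ) :
    Measurable (hp.scaledIntegrand s N) := by
  have h1 : Measurable fun θ : Fin d → ℝ => (N : ℝ)⁻¹ • θ := by fun_prop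
  have h2 := hp.continuous_charFn.measurable.comp h1
  exact ((measurable_one.indicator measurableSet_cell).comp h1).mul
    (((h2.const_sub 1).const_mul _).const_mul s).neg.exp

/-- A uniform bound for the rescaled transition probabilities. -/
lemma IsWalkKernel.exists_pow_mul_walkProb_le (hp : IsWalkKernel p) {s : ℝ≥0} (hs : 0 < s) :
    ∃ C : ℝ, 0 ≤ C ∧ ∀ N : ℕ, 0 < N → ∀ w : Lattice d,
      (N : ℝ) ^ d * walkProb p ((N : ℝ≥0) ^ 2 * s) 0 w ≤ C := by
  obtain ⟨g, hg, h⟩ := hp.exists_scaledIntegrand_le (s := s) (by exact_mod_cast hs)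
  have hg0 : 0 ≤ ∫ θ, g θ := integral_nonneg fun θ => (abs_nonneg _).trans (h 1 one_pos θ)
  have hpi := Real.pi_pos
  refine ⟨((2 * Real.pi) ^ d)⁻¹ * ∫ θ, g θ, by positivity, fun N hN w => ?_⟩
  rw [← div_eq_inv_mul, le_div_iff₀ (by positivity), mul_comm, hp.pow_mul_walkProb s hN w]
  refine (Real.le_norm_self _).trans (norm_integral_le_of_norm_le hg (Eventually.of_forall fun θ => ?_))
  rw [norm_mul]
  exact (mul_le_of_le_one_left (norm_nonneg _) (Real.abs_cos_le_one _)).trans (h N hN θ)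

/-- The local central limit theorem. -/
lemma IsWalkKernel.tendsto_pow_mul_walkProb (hp : IsWalkKernel p) {s : ℝ≥0} (hs : 0 < s)
    {u : ℕ → Lattice d} {v : Fin d → ℝ}
    (hu : ∀ i, Tendsto (fun N : ℕ => (u N i : ℝ) / N) atTop (𝓝 (v i))) :
    Tendsto (fun N : ℕ => (N : ℝ) ^ d * walkProb p ((N : ℝ≥0) ^ 2 * s) 0 (u N)) atTop
      (𝓝 (heatKernel (jumpCov p) s v)) := by
  have hs' : (0 : ℝ) < s := by exact_mod_cast hs
  have hpi := Real.pi_pos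
  have hc : ((2 * Real.pi) ^ d : ℝ) ≠ 0 := by positivity
  obtain ⟨g, hg, h⟩ := hp.exists_scaledIntegrand_le hs'
  have h1 : Tendsto (fun N : ℕ => ∫ θ, Real.cos (∑ i, θ i * ((u N i : ℝ) / N)) *
      hp.scaledIntegrand s N θ) atTop (𝓝 (∫ θ : Fin d → ℝ, Real.cos (∑ i, θ i * v i) *
        Real.exp (-(s / 2 * dotProduct θ ((jumpCov p).mulVec θ))))) := by
    refine tendsto_integral_filter_of_dominated_convergence g ?_ ?_ hg ?_
    · refine Eventually.of_forall fun N => ?_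
      exact ((Continuous.measurable (by fun_prop)).mul
        (hp.measurable_scaledIntegrand s N)).aestronglyMeasurable
    · filter_upwards [eventually_gt_atTop 0] with N hN
      refine Eventually.of_forall fun θ => ?_
      rw [norm_mul]
      exact (mul_le_of_le_one_left (norm_nonneg _) (Real.abs_cos_le_one _)).trans (h N hN θ)
    · refine Eventually.of_forall fun θ => Tendsto.mul ?_ ?_
      · exact (Real.continuous_cos.tendsto _).comp
          (tendsto_finsetSum _ fun i _ => (hu i).const_mul (θ i))
      · have h2 := ((hp.tendsto_sq_mul_one_sub_charFn θ).const_mul (s : ℝ)).neg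
        have h3 := (Real.continuous_exp.tendsto _).comp h2
        rw [show (s : ℝ) / 2 * dotProduct θ ((jumpCov p).mulVec θ) =
          s * (dotProduct θ ((jumpCov p).mulVec θ) / 2) by ring]
        refine h3.congr' ?_
        filter_upwards [eventually_smul_mem_cell θ] with N hN
        simp [IsWalkKernel.scaledIntegrand, hN]
  rw [integral_cos_mul_exp_neg_quadratic hs' hp.posDef_jumpCov, mul_assoc ((2 * Real.pi) ^ d)] at h1
  have h2 := h1.const_mul ((2 * Real.pi) ^ d)⁻¹
  rw [inv_mul_cancel_left₀ hc] at h2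
  refine h2.congr' ?_
  filter_upwards [eventually_gt_atTop 0] with N hN
  rw [← hp.pow_mul_walkProb s hN, inv_mul_cancel_left₀ hc]

end LocalLimit

end IRW

/-! ### Lattice sums as integrals of step functions. -/

namespace IRW

section Riemann

variable {d : ℕ}

/-- The lattice point `⌊N x⌋`. -/
noncomputable def latticePoint (N : ℕ) (x : EuclideanSpace ℝ (Fin d)) : Lattice d :=
  fun i => ⌊(N : ℝ) * x i⌋

lemma measurable_latticePoint (N : ℕ) : Measurable (latticePoint (d := d) N) := by
  refine measurable_pi_lambda _ fun i => Int.measurable_floor.comp ?_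
  fun_prop

lemma abs_floor_div_sub_le {N : ℕ} (hN : 0 < N) (a : ℝ) :
    |(⌊(N : ℝ) * a⌋ : ℝ) / N - a| ≤ 1 / N := by
  have hN' : (0 : ℝ) < N := by exact_mod_cast hN
  have h1 := Int.floor_le ((N : ℝ) * a)
  have h2 := Int.lt_floor_add_one ((N : ℝ) * a)
  have e : (⌊(N : ℝ) * a⌋ : ℝ) / N - a = (⌊(N : ℝ) * a⌋ - N * a) / N := by field_simp
  rw [e, abs_div, Nat.abs_cast]
  gcongr
  rw [abs_le]
  constructor <;> linarith

lemma tendsto_floor_div (a : ℝ) :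
    Tendsto (fun N : ℕ => (⌊(N : ℝ) * a⌋ : ℝ) / N) atTop (𝓝 a) := by
  rw [tendsto_iff_dist_tendsto_zero]
  refine squeeze_zero' (Eventually.of_forall fun _ => dist_nonneg) ?_
    tendsto_one_div_atTop_nhds_zero_nat
  filter_upwards [eventually_gt_atTop 0] with N hN
  exact abs_floor_div_sub_le hN a

lemma tendsto_scaled_latticePoint (x : EuclideanSpace ℝ (Fin d)) :
    Tendsto (fun N : ℕ => scaled N (latticePoint N x)) atTop (𝓝 x) :=
  ((PiLp.continuous_toLp 2 _).tendsto _).comp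
    (tendsto_pi_nhds.2 fun i => tendsto_floor_div (x i))

lemma norm_scaled_latticePoint_sub_le {N : ℕ} (hN : 0 < N) (x : EuclideanSpace ℝ (Fin d)) :
    ‖scaled N (latticePoint N x) - x‖ ≤ √d := by
  rw [EuclideanSpace.norm_eq]
  refine Real.sqrt_le_sqrt ?_
  calc ∑ i, ‖(scaled N (latticePoint N x) - x) i‖ ^ 2 ≤ ∑ _i : Fin d, (1 : ℝ) := by
        refine Finset.sum_le_sum fun i _ => pow_le_one₀ (norm_nonneg _) ?_
        refine (abs_floor_div_sub_le hN (x i)).trans ?_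
        rw [div_le_one (by exact_mod_cast hN)]
        exact_mod_cast hN
    _ = d := by simp

/-- The points with `⌊N x⌋ = z` form a cube of side `1 / N`. Summable lattice sums are therefore
exactly integrals over the continuum, and only the integrand has to converge. -/
lemma map_latticePoint {N : ℕ} (hN : 0 < N) :
    (volume : Measure (EuclideanSpace ℝ (Fin d))).map (latticePoint N) =
      ENNReal.ofReal (((N : ℝ) ^ d)⁻¹) • Measure.count := by
  have hN' : (0 : ℝ) < N := by exact_mod_cast hN
  refine Measure.ext_of_singleton fun z => ?_
  rw [Measure.map_apply (measurable_latticePoint N) (measurableSet_singleton z),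
    Measure.smul_apply, Measure.count_singleton, smul_eq_mul, mul_one]
  have e : latticePoint N ⁻¹' {z} = (WithLp.ofLp : EuclideanSpace ℝ (Fin d) → Fin d → ℝ) ⁻¹'
      Set.pi Set.univ fun i => Set.Ico ((z i : ℝ) / N) (((z i : ℝ) + 1) / N) := by
    ext x
    simp only [Set.mem_preimage, Set.mem_singleton_iff, funext_iff, latticePoint, Int.floor_eq_iff,
      Set.mem_pi, Set.mem_univ, true_imp_iff, Set.mem_Ico, div_le_iff₀ hN', lt_div_iff₀ hN',
      mul_comm]
  rw [e, (PiLp.volume_preserving_ofLp (Fin d)).measure_preimage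
    (MeasurableSet.univ_pi fun i => measurableSet_Ico).nullMeasurableSet, volume_pi_pi]
  simp only [Real.volume_Ico, ← sub_div, add_sub_cancel_left]
  rw [Finset.prod_const, Finset.card_univ, Fintype.card_fin, ← ENNReal.ofReal_pow (by positivity),
    one_div, inv_pow]

lemma map_latticePoint_prod {N : ℕ} (hN : 0 < N) :
    (volume : Measure (EuclideanSpace ℝ (Fin d) × EuclideanSpace ℝ (Fin d))).map
      (Prod.map (latticePoint N) (latticePoint N)) =
      ENNReal.ofReal (((N : ℝ) ^ (2 * d))⁻¹) • Measure.count := by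
  rw [Measure.volume_eq_prod, ← Measure.map_prod_map _ _ (measurable_latticePoint N)
    (measurable_latticePoint N), map_latticePoint hN]
  refine Measure.ext_of_singleton fun q => ?_
  have e : ({q} : Set (Lattice d × Lattice d)) = {q.1} ×ˢ {q.2} := by simp
  rw [Measure.smul_apply, Measure.count_singleton, e, Measure.prod_prod]
  simp only [Measure.smul_apply, Measure.count_singleton, smul_eq_mul, mul_one]
  rw [← ENNReal.ofReal_mul (by positivity), ← mul_inv, two_mul, pow_add]

lemma integral_latticePoint_prod {N : ℕ} (hN : 0 < N) {F : Lattice d × Lattice d → ℝ}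
    (hF : Summable F) :
    ∫ q : EuclideanSpace ℝ (Fin d) × EuclideanSpace ℝ (Fin d),
      F (latticePoint N q.1, latticePoint N q.2) = ((N : ℝ) ^ (2 * d))⁻¹ * ∑' q, F q := by
  have hm : Measurable (Prod.map (latticePoint (d := d) N) (latticePoint (d := d) N)) :=
    (measurable_latticePoint N).prodMap (measurable_latticePoint N)
  have h := integral_map (μ := volume) hm.aemeasurable
    (Measurable.of_discrete (f := F)).aestronglyMeasurable
  rw [map_latticePoint_prod hN, integral_smul_measure, ENNReal.toReal_ofReal (by positivity)] at h
  rw [integral_countable (integrable_count_iff.2 hF.norm)] at h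
  simpa [measureReal_def, Prod.map] using h.symm

/-- An integrable majorant of all the step functions obtained from a Schwartz function. -/
lemma exists_schwartz_majorant (φ : SchwartzMap (EuclideanSpace ℝ (Fin d)) ℝ) :
    ∃ g : EuclideanSpace ℝ (Fin d) → ℝ, Integrable g ∧
      ∀ N : ℕ, 0 < N → ∀ x, |φ (scaled N (latticePoint N x))| ≤ g x := by
  set C : ℝ := 2 ^ (d + 1) * ((Finset.Iic (d + 1, 0)).sup
    fun m => SchwartzMap.seminorm ℝ m.1 m.2) φ with hC
  have hφ : ∀ y, (1 + ‖y‖) ^ (d + 1) * |φ y| ≤ C := fun y => by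
    have := SchwartzMap.one_add_le_sup_seminorm_apply (𝕜 := ℝ) (m := (d + 1, 0)) le_rfl le_rfl φ y
    simpa using this
  have hC0 : 0 ≤ C := le_trans (by positivity) (hφ 0)
  refine ⟨fun x => C * (1 + √d) ^ (d + 1) * (1 + ‖x‖) ^ (-((d : ℝ) + 1)),
    (integrable_one_add_norm (by simp)).const_mul _, fun N hN x => ?_⟩
  set y := scaled N (latticePoint N x) with hy
  -- For `N ≥ 1`, rounding moves `x` by at most `√d`, so the weights at `x` and `y` are comparable
  -- uniformly in `N`. The power `d + 1` exceeds the dimension and makes the majorant integrable.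
  have h1 : 1 + ‖x‖ ≤ (1 + √d) * (1 + ‖y‖) := by
    have h2 : ‖x‖ ≤ ‖y‖ + √d := by
      have := norm_sub_norm_le x y
      rw [norm_sub_rev] at this
      linarith [norm_scaled_latticePoint_sub_le hN x]
    nlinarith [Real.sqrt_nonneg (d : ℝ), norm_nonneg y,
      mul_nonneg (Real.sqrt_nonneg (d : ℝ)) (norm_nonneg y)]
  have h3 : (1 + ‖x‖) ^ (d + 1) ≤ (1 + √d) ^ (d + 1) * (1 + ‖y‖) ^ (d + 1) := by
    rw [← mul_pow]
    exact pow_le_pow_left₀ (by positivity) h1 _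
  have e : (1 + ‖x‖) ^ (-((d : ℝ) + 1)) = ((1 + ‖x‖) ^ (d + 1))⁻¹ := by
    rw [Real.rpow_neg (by positivity)]
    congr 1
    exact_mod_cast Real.rpow_natCast (1 + ‖x‖) (d + 1)
  simp only [e]
  rw [← div_eq_mul_inv, le_div_iff₀ (by positivity)]
  calc |φ y| * (1 + ‖x‖) ^ (d + 1)
      ≤ |φ y| * ((1 + √d) ^ (d + 1) * (1 + ‖y‖) ^ (d + 1)) := by gcongr
    _ = (1 + √d) ^ (d + 1) * ((1 + ‖y‖) ^ (d + 1) * |φ y|) := by ring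
    _ ≤ (1 + √d) ^ (d + 1) * C := by gcongr; exact hφ y
    _ = _ := by ring

lemma summable_abs_schwartz_scaled (φ : SchwartzMap (EuclideanSpace ℝ (Fin d)) ℝ) {N : ℕ}
    (hN : 0 < N) : Summable fun z : Lattice d => |φ (scaled N z)| := by
  obtain ⟨g, hg, h⟩ := exists_schwartz_majorant φ
  have h1 : Integrable ((fun z : Lattice d => φ (scaled N z)) ∘ latticePoint N)
      (volume : Measure (EuclideanSpace ℝ (Fin d))) :=
    hg.mono' (Measurable.of_discrete.comp (measurable_latticePoint N)).aestronglyMeasurable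
      (Eventually.of_forall fun x => h N hN x)
  rw [← integrable_map_measure Measurable.of_discrete.aestronglyMeasurable
    (measurable_latticePoint N).aemeasurable, map_latticePoint hN,
    integrable_smul_measure (by
      rw [ne_eq, ENNReal.ofReal_eq_zero, not_le]; positivity) ENNReal.ofReal_ne_top] at h1
  exact integrable_count_iff.1 h1

lemma summable_schwartz_prod_mul (φ : SchwartzMap (EuclideanSpace ℝ (Fin d)) ℝ) {N : ℕ}
    (hN : 0 < N) {A : Lattice d × Lattice d → ℝ} {C : ℝ} (hA : ∀ q, |A q| ≤ C) :
    Summable fun q : Lattice d × Lattice d => φ (scaled N q.1) * φ (scaled N q.2) * A q := by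
  have h := summable_abs_schwartz_scaled φ hN
  have h2 := (h.mul_of_nonneg h (fun _ => abs_nonneg _) fun _ => abs_nonneg _).mul_right C
  refine Summable.of_norm_bounded h2 fun q => ?_
  rw [norm_mul, norm_mul]
  exact mul_le_mul_of_nonneg_left (hA q) (by positivity)

/-- Convergence of the rescaled double sums to the corresponding double integral. -/
lemma tendsto_double_sum (φ : SchwartzMap (EuclideanSpace ℝ (Fin d)) ℝ) {A : ℕ → Lattice d → ℝ}
    {G : (Fin d → ℝ) → ℝ} {C : ℝ} (hA : ∀ N, 0 < N → ∀ w, |A N w| ≤ C)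
    -- Convergence along every sequence with `u N / N → v` is required because the integrand is
    -- evaluated at lattice points that move with `N`.
    (hlim : ∀ (u : ℕ → Lattice d) (v : Fin d → ℝ),
      (∀ i, Tendsto (fun N : ℕ => (u N i : ℝ) / N) atTop (𝓝 (v i))) →
        Tendsto (fun N => A N (u N)) atTop (𝓝 (G v))) :
    Tendsto (fun N : ℕ => ((N : ℝ) ^ (2 * d))⁻¹ * ∑' q : Lattice d × Lattice d,
      φ (scaled N q.1) * φ (scaled N q.2) * A N (q.2 - q.1)) atTop
      (𝓝 (∫ q : EuclideanSpace ℝ (Fin d) × EuclideanSpace ℝ (Fin d),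
        φ q.1 * φ q.2 * G (WithLp.ofLp (q.2 - q.1)))) := by
  obtain ⟨g, hg, h⟩ := exists_schwartz_majorant φ
  have hC : 0 ≤ C := (abs_nonneg _).trans (hA 1 one_pos 0)
  have key : Tendsto (fun N : ℕ => ∫ q : EuclideanSpace ℝ (Fin d) × EuclideanSpace ℝ (Fin d),
      φ (scaled N (latticePoint N q.1)) * φ (scaled N (latticePoint N q.2)) *
        A N (latticePoint N q.2 - latticePoint N q.1)) atTop
      (𝓝 (∫ q : EuclideanSpace ℝ (Fin d) × EuclideanSpace ℝ (Fin d),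
        φ q.1 * φ q.2 * G (WithLp.ofLp (q.2 - q.1)))) := by
    refine tendsto_integral_filter_of_dominated_convergence (fun q => g q.1 * g q.2 * C) ?_ ?_
      ((hg.mul_prod hg).mul_const C) ?_
    · refine Eventually.of_forall fun N => Measurable.aestronglyMeasurable ?_
      have h1 : Measurable fun q : Lattice d × Lattice d =>
          φ (scaled N q.1) * φ (scaled N q.2) * A N (q.2 - q.1) := Measurable.of_discrete
      have h2 : Measurable fun q : EuclideanSpace ℝ (Fin d) × EuclideanSpace ℝ (Fin d) =>
          (latticePoint N q.1, latticePoint N q.2) :=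
        ((measurable_latticePoint N).comp measurable_fst).prodMk
          ((measurable_latticePoint N).comp measurable_snd)
      have h3 := h1.comp h2
      simpa only [Function.comp_def] using h3
    · filter_upwards [eventually_gt_atTop 0] with N hN
      refine Eventually.of_forall fun q => ?_
      simp only [norm_mul, Real.norm_eq_abs]
      have h0 : ∀ x, 0 ≤ g x := fun x => (abs_nonneg _).trans (h N hN x)
      have h1 := mul_le_mul (h N hN q.1) (h N hN q.2) (abs_nonneg _) (h0 _)
      exact mul_le_mul h1 (hA N hN (latticePoint N q.2 - latticePoint N q.1)) (abs_nonneg _)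
        (mul_nonneg (h0 _) (h0 _))
    · refine Eventually.of_forall fun q => Tendsto.mul (Tendsto.mul ?_ ?_) ?_
      · exact (φ.continuous.tendsto _).comp (tendsto_scaled_latticePoint q.1)
      · exact (φ.continuous.tendsto _).comp (tendsto_scaled_latticePoint q.2)
      · refine hlim _ _ fun i => ?_
        have := (tendsto_floor_div (q.2 i)).sub (tendsto_floor_div (q.1 i))
        simpa [latticePoint, sub_div] using this
  refine key.congr' ?_
  filter_upwards [eventually_gt_atTop 0] with N hN
  exact integral_latticePoint_prod hN
    (summable_schwartz_prod_mul φ hN (A := fun q => A N (q.2 - q.1)) fun q => hA N hN _)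

end Riemann

end IRW

/-! ### Series of integrable functions. -/

namespace IRW

open scoped ENNReal

section Series

variable {Ω ι : Type*} [MeasurableSpace Ω] {P : Measure Ω} {F : ι → Ω → ℝ}

lemma tsum_lintegral_enorm_ne_top (hF : ∀ i, Integrable (F i) P)
    (hs : Summable fun i => ∫ ω, |F i ω| ∂P) : ∑' i, ∫⁻ ω, ‖F i ω‖ₑ ∂P ≠ ⊤ := by
  have h : ∀ i, ∫⁻ ω, ‖F i ω‖ₑ ∂P = ENNReal.ofReal (∫ ω, |F i ω| ∂P) := fun i =>
    (ofReal_integral_norm_eq_lintegral_enorm (hF i)).symm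
  rw [tsum_congr h, ← ENNReal.ofReal_tsum_of_nonneg
    (fun i => integral_nonneg fun ω => abs_nonneg _) hs]
  exact ENNReal.ofReal_ne_top

variable [Countable ι]

lemma ae_tsum_enorm_lt_top (hF : ∀ i, Integrable (F i) P)
    (hs : Summable fun i => ∫ ω, |F i ω| ∂P) : ∀ᵐ ω ∂P, ∑' i, ‖F i ω‖ₑ < ⊤ := by
  refine ae_lt_top' (AEMeasurable.tsum fun i => (hF i).1.enorm) ?_
  rw [lintegral_tsum fun i => (hF i).1.enorm]
  exact tsum_lintegral_enorm_ne_top hF hs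

lemma ae_summable_of_summable_integral_abs (hF : ∀ i, Integrable (F i) P)
    (hs : Summable fun i => ∫ ω, |F i ω| ∂P) : ∀ᵐ ω ∂P, Summable fun i => F i ω := by
  filter_upwards [ae_tsum_enorm_lt_top hF hs] with ω hω
  have h : Summable fun i => ‖F i ω‖₊ := ENNReal.tsum_coe_ne_top_iff_summable.1 hω.ne
  exact Summable.of_nnnorm h

lemma integrable_tsum_of_summable_integral_abs (hF : ∀ i, Integrable (F i) P)
    (hs : Summable fun i => ∫ ω, |F i ω| ∂P) : Integrable (fun ω => ∑' i, F i ω) P := by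
  refine ⟨AEMeasurable.aestronglyMeasurable ?_, ?_⟩
  · exact AEMeasurable.tsum fun i => (hF i).1.aemeasurable
  · refine lt_of_le_of_lt (lintegral_mono fun ω => enorm_tsum_le_tsum_enorm) ?_
    rw [lintegral_tsum fun i => (hF i).1.enorm]
    exact (tsum_lintegral_enorm_ne_top hF hs).lt_top

end Series

/-! ### Correlations of the fluctuation fields. -/

section FieldCorrelation

variable {d k : ℕ} {ρ : ℝ≥0} {p : Lattice d → Lattice d → ℝ}

lemma walkProb_le_one_of_law {t : ℝ≥0} {κ : Lattice d → Measure (Lattice d)}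
    [∀ x, IsProbabilityMeasure (κ x)] (hκ : ∀ a b, (κ a).real {b} = walkProb p t a b)
    (a b : Lattice d) : walkProb p t a b ≤ 1 := by
  rw [← hκ]; exact measureReal_le_one

lemma labeledProb_nonneg (hp : IsWalkKernel p) (t : ℝ≥0) (x y : Fin k → Lattice d) :
    0 ≤ labeledProb p t x y :=
  Finset.prod_nonneg fun _ _ => walkProb_nonneg hp t _ _

/-- The permutation classes of a shifted vector. -/
def permClassShift (z : Lattice d) (x : Fin k → Lattice d) :
    PermClass (shift z x) ≃ PermClass x :=
  Quotient.congrRight fun _ _ => forall_congr' fun _ => add_right_inj z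

lemma permuted_shift (z : Lattice d) (x : Fin k → Lattice d) (σ : PermClass (shift z x)) :
    permuted (shift z x) σ = shift z (permuted x (permClassShift z x σ)) := by
  induction σ using Quotient.inductionOn with | _ σ =>
  rfl

variable {Ω : Type*} [MeasurableSpace Ω] {P : Measure Ω} [IsProbabilityMeasure P]
  {κ : Lattice d → Measure (Lattice d)} [∀ x, IsProbabilityMeasure (κ x)]
  {N₀ N₁ : Ω → Config d} {Z : Lattice d × ℕ → Ω → Lattice d}

lemma Evolution.integral_duality_shift (h : Evolution P ρ κ N₀ N₁ Z) (hp : IsWalkKernel p)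
    {t : ℝ≥0} (hκ : ∀ a b, (κ a).real {b} = walkProb p t a b) (hρ : 0 < ρ) (c : ℝ)
    (x : Fin k → Lattice d) (y z : Lattice d) :
    ∫ ω, duality ρ c (configOf (shift y x)) (N₁ ω) * duality ρ c (configOf (shift z x)) (N₀ ω) ∂P =
      dualityNormSq ρ c (configOf x) *
        ∑ σ : PermClass x, labeledProb p t x (shift (z - y) (permuted x σ)) := by
  rw [h.integral_duality_mul_duality hρ, dualityNormSq_shift,
    ← (permClassShift z x).sum_comp]
  congr 1
  refine Finset.sum_congr rfl fun σ _ => Finset.prod_congr rfl fun i _ => ?_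
  rw [hκ, permuted_shift, walkProb_translation hp, walkProb_translation hp t (x i)]
  congr 1
  simp only [shift]
  abel

/-- The two-time bound with no particle at time zero: the second polynomial is then the constant
`1`. -/
lemma Evolution.exists_integral_abs_duality_one_le (h : Evolution P ρ κ N₀ N₁ Z) (c : ℝ) (k : ℕ) :
    ∃ C : ℝ, 0 ≤ C ∧ ∀ x : Fin k → Lattice d,
      Integrable (fun ω => duality ρ c (configOf x) (N₁ ω)) P ∧
        ∫ ω, |duality ρ c (configOf x) (N₁ ω)| ∂P ≤ C := by
  obtain ⟨C, hC, hb⟩ := h.exists_integral_abs_duality_le c k 0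
  have e : ∀ η : Config d, duality ρ c (configOf (Fin.elim0 : Fin 0 → Lattice d)) η = 1 := by
    intro η; simp [configOf, duality]
  refine ⟨C, hC, fun x => ⟨?_, ?_⟩⟩
  · simpa [e] using (h.integral_duality_mul c x (duality_polyBounded (ρ := ρ) c Fin.elim0)).1
  · simpa [e] using hb x Fin.elim0

lemma Evolution.exists_integral_abs_duality_zero_le (h : Evolution P ρ κ N₀ N₁ Z) (c : ℝ)
    (k : ℕ) : ∃ C : ℝ, 0 ≤ C ∧ ∀ x : Fin k → Lattice d,
      Integrable (fun ω => duality ρ c (configOf x) (N₀ ω)) P ∧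
        ∫ ω, |duality ρ c (configOf x) (N₀ ω)| ∂P ≤ C := by
  obtain ⟨C, hC, hb⟩ := h.exists_integral_abs_duality_le c 0 k
  have e : ∀ η : Config d, duality ρ c (configOf (Fin.elim0 : Fin 0 → Lattice d)) η = 1 := by
    intro η; simp [configOf, duality]
  refine ⟨C, hC, fun x => ⟨?_, ?_⟩⟩
  · simpa [e] using (h.integral_duality_mul c Fin.elim0 (duality_polyBounded c x)).1
  · simpa [e] using hb Fin.elim0 x

lemma ae_summable_fieldTerm {Ω : Type*} [MeasurableSpace Ω] {P : Measure Ω} (c : ℝ)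
    {N : ℕ} (hN : 0 < N) (x : Fin k → Lattice d)
    (φ : SchwartzMap (EuclideanSpace ℝ (Fin d)) ℝ) {η : Ω → Config d}
    (h : ∃ C : ℝ, 0 ≤ C ∧ ∀ x : Fin k → Lattice d,
      Integrable (fun ω => duality ρ c (configOf x) (η ω)) P ∧
        ∫ ω, |duality ρ c (configOf x) (η ω)| ∂P ≤ C) :
    ∀ᵐ ω ∂P, Summable (fieldTerm ρ c N x (η ω) φ) := by
  obtain ⟨C, hC, h⟩ := h
  refine ae_summable_of_summable_integral_abs (F := fun z ω => fieldTerm ρ c N x (η ω) φ z)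
    (fun z => (h (shift z x)).1.const_mul _) ?_
  refine Summable.of_nonneg_of_le (fun z => integral_nonneg fun ω => abs_nonneg _) (fun z => ?_)
    ((summable_abs_schwartz_scaled φ hN).mul_right C)
  simp only [fieldTerm, abs_mul, integral_const_mul]
  exact mul_le_mul_of_nonneg_left (h _).2 (abs_nonneg _)

lemma summable_mul_labeledProb (hp : IsWalkKernel p) {t : ℝ≥0}
    (hκ : ∀ a b, (κ a).real {b} = walkProb p t a b) {N : ℕ} (hN : 0 < N)
    (x : Fin k → Lattice d) (φ : SchwartzMap (EuclideanSpace ℝ (Fin d)) ℝ) (σ : PermClass x) :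
    Summable fun q : Lattice d × Lattice d => φ (scaled N q.1) * φ (scaled N q.2) *
      labeledProb p t x (shift (q.2 - q.1) (permuted x σ)) := by
  refine summable_schwartz_prod_mul φ hN (C := 1)
    (A := fun q => labeledProb p t x (shift (q.2 - q.1) (permuted x σ))) fun q => ?_
  rw [abs_of_nonneg (labeledProb_nonneg hp t _ _)]
  exact Finset.prod_le_one (fun _ _ => walkProb_nonneg hp t _ _)
    fun _ _ => walkProb_le_one_of_law hκ _ _

/-- The space-time correlations of the fluctuation fields. -/
lemma Evolution.field_correlation (h : Evolution P ρ κ N₀ N₁ Z) (hp : IsWalkKernel p)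
    {t : ℝ≥0} (hκ : ∀ a b, (κ a).real {b} = walkProb p t a b) (hρ : 0 < ρ) (c : ℝ)
    {N : ℕ} (hN : 0 < N) (x : Fin k → Lattice d)
    (φ : SchwartzMap (EuclideanSpace ℝ (Fin d)) ℝ) :
    Integrable (fun ω => field ρ c N x (N₁ ω) φ * field ρ c N x (N₀ ω) φ) P ∧
      ∫ ω, field ρ c N x (N₁ ω) φ * field ρ c N x (N₀ ω) φ ∂P =
        dualityNormSq ρ c (configOf x) * ∑ σ : PermClass x, ∑' q : Lattice d × Lattice d,
          φ (scaled N q.1) * φ (scaled N q.2) *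
            labeledProb p t x (shift (q.2 - q.1) (permuted x σ)) := by
  obtain ⟨C, hC, hb⟩ := h.exists_integral_abs_duality_le c k k
  let T : Lattice d × Lattice d → Ω → ℝ := fun q ω =>
    fieldTerm ρ c N x (N₁ ω) φ q.1 * fieldTerm ρ c N x (N₀ ω) φ q.2
  have eT : ∀ q ω, T q ω = φ (scaled N q.1) * φ (scaled N q.2) *
      (duality ρ c (configOf (shift q.1 x)) (N₁ ω) *
        duality ρ c (configOf (shift q.2 x)) (N₀ ω)) := fun q ω => by
    simp only [T, fieldTerm]; ring
  have hT : ∀ q, Integrable (T q) P := fun q => by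
    have := ((h.integral_duality_mul c (shift q.1 x)
      (duality_polyBounded (ρ := ρ) c (shift q.2 x))).1).const_mul (φ (scaled N q.1) * φ (scaled N q.2))
    exact this.congr (Eventually.of_forall fun ω => (eT q ω).symm)
  have hs := summable_abs_schwartz_scaled φ hN
  have hsum : Summable fun q => ∫ ω, |T q ω| ∂P := by
    refine Summable.of_nonneg_of_le (fun q => integral_nonneg fun ω => abs_nonneg _) (fun q => ?_)
      ((hs.mul_of_nonneg hs (fun _ => abs_nonneg _) fun _ => abs_nonneg _).mul_right C)
    simp only [eT]
    simp only [abs_mul (φ (scaled N q.1) * φ (scaled N q.2)), integral_const_mul]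
    rw [← abs_mul]
    exact mul_le_mul_of_nonneg_left (hb _ _) (abs_nonneg _)
  have hprod : (fun ω => field ρ c N x (N₁ ω) φ * field ρ c N x (N₀ ω) φ) =ᵐ[P]
      fun ω => ∑' q, T q ω := by
    filter_upwards [ae_summable_fieldTerm c hN x φ (h.exists_integral_abs_duality_one_le c k),
      ae_summable_fieldTerm c hN x φ (h.exists_integral_abs_duality_zero_le c k)] with ω h1 h0
    -- The product of the fields is a double series only where both converge absolutely, hence the
    -- almost sure statements.
    exact tsum_mul_tsum_of_summable_norm h1.norm h0.norm
  refine ⟨(integrable_tsum_of_summable_integral_abs hT hsum).congr hprod.symm, ?_⟩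
  rw [integral_congr_ae hprod, ← integral_tsum_of_summable_integral_norm hT hsum]
  have eI : ∀ q, ∫ ω, T q ω ∂P = ∑ σ : PermClass x, dualityNormSq ρ c (configOf x) *
      (φ (scaled N q.1) * φ (scaled N q.2) *
        labeledProb p t x (shift (q.2 - q.1) (permuted x σ))) := fun q => by
    simp only [eT]
    rw [integral_const_mul, h.integral_duality_shift hp hκ hρ, Finset.mul_sum, Finset.mul_sum]
    exact Finset.sum_congr rfl fun σ _ => by ring
  rw [tsum_congr eI, Summable.tsum_finsetSum fun σ _ =>
    (summable_mul_labeledProb hp hκ hN x φ σ).mul_left _, Finset.mul_sum]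
  exact Finset.sum_congr rfl fun σ _ => tsum_mul_left

/-- Only the positions at the single time `t` matter from here on; the rest of the path structure is
dropped. -/
lemma IsEquilibriumWalkers.exists_evolution {η : ℝ≥0 → Ω → Config d} (hp : IsWalkKernel p)
    (hη : IsEquilibriumWalkers p ρ P η) (t : ℝ≥0) :
    ∃ (κ : Lattice d → Measure (Lattice d)) (Z : Lattice d × ℕ → Ω → Lattice d),
      (∀ x, IsProbabilityMeasure (κ x)) ∧ (∀ a b, (κ a).real {b} = walkProb p t a b) ∧
        Evolution P ρ κ (η 0) (η t) Z := by
  obtain ⟨hlaw, Y, hY, hind, hind0, hcount⟩ := hη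
  have hY' : ∀ l u, P {ω | Y l t ω = u} = ENNReal.ofReal (walkProb p t l.1 u) := by
    intro l u
    rw [walkProb_translation hp, ← (hY l).increment_law 0 t, zero_add]
    refine measure_congr ?_
    filter_upwards [(hY l).start] with ω hω
    refine propext ?_
    change Y l t ω = u ↔ Y l t ω - Y l 0 ω = u - l.1
    rw [hω, sub_left_inj]
  have hκ : ∀ a b, P.map (Y (a, 0) t) {b} = ENNReal.ofReal (walkProb p t a b) := fun a b => by
    rw [Measure.map_apply ((hY _).measurable t) (measurableSet_singleton b)]
    exact hY' (a, 0) b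
  -- All labels carry walks, whether or not the particle is present, so the walk labelled `(a, 0)`
  -- always provides the law of a walker started at `a`.
  refine ⟨fun a => P.map (Y (a, 0) t), fun l => Y l t, fun a =>
    Measure.isProbabilityMeasure_map ((hY _).measurable t).aemeasurable, fun a b => ?_, ?_⟩
  · rw [measureReal_def, hκ, ENNReal.toReal_ofReal (walkProb_nonneg hp t a b)]
  · refine ⟨hlaw, fun l => (hY l).measurable t, ?_, ?_, fun l u => ?_, hcount t⟩
    · exact hind.comp (fun _ y => y t) fun _ => measurable_pi_apply t
    · refine hind0.comp (φ := id) (ψ := fun (y : Lattice d × ℕ → ℝ≥0 → Lattice d) l => y l t)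
        measurable_id ?_
      exact measurable_pi_lambda _ fun l => (measurable_pi_apply t).comp (measurable_pi_apply l)
    · rw [hκ, hp.walkProb_symm]
      exact hY' l u

end FieldCorrelation

end IRW

/-! ### The scaling limit. -/

namespace IRW

section ScalingLimit

variable {d k : ℕ} {p : Lattice d → Lattice d → ℝ}

lemma labeledProb_shift (hp : IsWalkKernel p) (t : ℝ≥0) (x y : Fin k → Lattice d)
    (w : Lattice d) :
    labeledProb p t x (shift w y) = ∏ i, walkProb p t 0 (w + (y i - x i)) := by
  refine Finset.prod_congr rfl fun i _ => ?_
  rw [walkProb_translation hp, shift, add_sub_assoc]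

/-- The scaling limit of the sums over lattice points weighted by the transition probabilities of
`k` labeled walkers. -/
lemma IsWalkKernel.tendsto_sum_labeledProb (hp : IsWalkKernel p) {t : ℝ≥0} (ht : 0 < t)
    (x y : Fin k → Lattice d) (φ : SchwartzMap (EuclideanSpace ℝ (Fin d)) ℝ) :
    Tendsto (fun N : ℕ => (N : ℝ) ^ ((d : ℤ) * ((k : ℤ) - 2)) *
      ∑' q : Lattice d × Lattice d, φ (scaled N q.1) * φ (scaled N q.2) *
        labeledProb p ((N : ℝ≥0) ^ 2 * t) x (shift (q.2 - q.1) y)) atTop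
      (𝓝 (∫ q : EuclideanSpace ℝ (Fin d) × EuclideanSpace ℝ (Fin d),
        φ q.1 * φ q.2 * heatKernel (jumpCov p) t (WithLp.ofLp (q.2 - q.1)) ^ k)) := by
  obtain ⟨C, hC, hb⟩ := hp.exists_pow_mul_walkProb_le ht
  have hnn : ∀ (N : ℕ) w, 0 ≤ (N : ℝ) ^ d * walkProb p ((N : ℝ≥0) ^ 2 * t) 0 w := fun N w =>
    mul_nonneg (by positivity) (walkProb_nonneg hp _ _ _)
  have h := tendsto_double_sum φ (C := C ^ k)
    (A := fun N w => ∏ i, (N : ℝ) ^ d * walkProb p ((N : ℝ≥0) ^ 2 * t) 0 (w + (y i - x i)))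
    (G := fun v => heatKernel (jumpCov p) t v ^ k) (fun N hN w => ?_) fun u v hu => ?_
  · refine h.congr' ?_
    filter_upwards [eventually_gt_atTop 0] with N hN
    have hN' : (N : ℝ) ≠ 0 := by positivity
    -- The exponent is an integer, negative for `k < 2` and `d > 0`. It splits into the volume of a
    -- cell in the double sum and one `N ^ d` per walker.
    have e : (N : ℝ) ^ ((d : ℤ) * ((k : ℤ) - 2)) = ((N : ℝ) ^ (2 * d))⁻¹ * ((N : ℝ) ^ d) ^ k := by
      rw [mul_sub, zpow_sub₀ hN', ← pow_mul, mul_comm 2 d, div_eq_inv_mul]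
      congr 1
    rw [e, mul_assoc, ← tsum_mul_left (a := ((N : ℝ) ^ d) ^ k)]
    congr 1
    refine tsum_congr fun q => ?_
    rw [labeledProb_shift hp, Finset.prod_mul_distrib, Finset.prod_const, Finset.card_univ,
      Fintype.card_fin]
    ring
  · rw [Finset.abs_prod]
    calc _ ≤ ∏ _i : Fin k, C := Finset.prod_le_prod (fun _ _ => abs_nonneg _) fun i _ => by
          rw [abs_of_nonneg (hnn _ _)]; exact hb N hN _
      _ = C ^ k := by simp
  · have e : heatKernel (jumpCov p) t v ^ k = ∏ _i : Fin k, heatKernel (jumpCov p) t v := by simp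
    rw [e]
    refine tendsto_finsetProd _ fun i _ => hp.tendsto_pow_mul_walkProb ht fun j => ?_
    -- The offsets between the walkers vanish at scale `N`, so the limit does not depend on `y`;
    -- summing over the classes then gives the factor `Fintype.card (PermClass x)`.
    have h0 : Tendsto (fun N : ℕ => ((y i j - x i j : ℤ) : ℝ) / N) atTop (𝓝 0) :=
      tendsto_const_div_atTop_nhds_zero_nat _
    simpa [add_div] using (hu j).add h0

lemma heatKernel_pow {Γ : Matrix (Fin d) (Fin d) ℝ} (hΓ : 0 ≤ Γ.det) {t : ℝ} (ht : 0 ≤ t)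
    (v : EuclideanSpace ℝ (Fin d)) :
    heatKernel Γ t (WithLp.ofLp v) ^ k =
      Γ.det ^ (-(k : ℝ) / 2) * (2 * Real.pi * t) ^ (-((d : ℝ) * (k : ℝ)) / 2) *
        Real.exp (-((k : ℝ) * quadForm Γ⁻¹ v) / (2 * t)) := by
  have hpi := Real.pi_pos
  rw [heatKernel, mul_pow, mul_pow, ← Real.exp_nat_mul, ← Real.rpow_natCast, ← Real.rpow_natCast,
    ← Real.rpow_mul hΓ, ← Real.rpow_mul (by positivity)]
  have e : (k : ℝ) * (-(WithLp.ofLp v ⬝ᵥ Γ⁻¹.mulVec (WithLp.ofLp v)) / (2 * t)) =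
      -((k : ℝ) * quadForm Γ⁻¹ v) / (2 * t) := by
    rw [mul_div_assoc', mul_neg]
    rfl
  rw [← e, show -(d : ℝ) / 2 * k = -((d : ℝ) * k) / 2 by ring,
    show -(1 : ℝ) / 2 * k = -(k : ℝ) / 2 by ring]

lemma quadForm_sub_comm (M : Matrix (Fin d) (Fin d) ℝ) (v w : EuclideanSpace ℝ (Fin d)) :
    quadForm M (v - w) = quadForm M (w - v) := by
  rw [← neg_sub w v]
  simp only [quadForm, WithLp.ofLp_neg, Matrix.mulVec_neg, neg_dotProduct, dotProduct_neg, neg_neg]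

variable {ρ : ℝ≥0} {Ω : Type*} [MeasurableSpace Ω] {P : Measure Ω} [IsProbabilityMeasure P]

/-- The scaling limit of the space-time correlations of the fluctuation fields. -/
lemma IsEquilibriumWalkers.tendsto_field_correlation {η : ℝ≥0 → Ω → Config d}
    (hη : IsEquilibriumWalkers p ρ P η) (hp : IsWalkKernel p) (hρ : 0 < ρ) (c : ℝ)
    (x : Fin k → Lattice d) (φ : SchwartzMap (EuclideanSpace ℝ (Fin d)) ℝ) {t : ℝ≥0}
    (ht : 0 < t) :
    Tendsto (fun N : ℕ => (N : ℝ) ^ ((d : ℤ) * ((k : ℤ) - 2)) *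
        ∫ ω, field ρ c N x (η ((N : ℝ≥0) ^ 2 * t) ω) φ * field ρ c N x (η 0 ω) φ ∂P) atTop
      (𝓝 ((Fintype.card (PermClass x) : ℝ) * dualityNormSq ρ c (configOf x) *
        ((jumpCov p).det ^ (-(k : ℝ) / 2) *
          (2 * Real.pi * (t : ℝ)) ^ (-((d : ℝ) * (k : ℝ)) / 2)) *
        ∫ q : EuclideanSpace ℝ (Fin d) × EuclideanSpace ℝ (Fin d),
          Real.exp (-((k : ℝ) * quadForm (jumpCov p)⁻¹ (q.1 - q.2)) / (2 * (t : ℝ))) *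
            φ q.1 * φ q.2)) := by
  have h := (tendsto_finsetSum (Finset.univ : Finset (PermClass x)) fun σ _ =>
    hp.tendsto_sum_labeledProb ht x (permuted x σ) φ).const_mul (dualityNormSq ρ c (configOf x))
  rw [Finset.sum_const, Finset.card_univ, nsmul_eq_mul] at h
  have e : ∫ q : EuclideanSpace ℝ (Fin d) × EuclideanSpace ℝ (Fin d),
      φ q.1 * φ q.2 * heatKernel (jumpCov p) t (WithLp.ofLp (q.2 - q.1)) ^ k =
      ((jumpCov p).det ^ (-(k : ℝ) / 2) *
          (2 * Real.pi * (t : ℝ)) ^ (-((d : ℝ) * (k : ℝ)) / 2)) *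
        ∫ q : EuclideanSpace ℝ (Fin d) × EuclideanSpace ℝ (Fin d),
          Real.exp (-((k : ℝ) * quadForm (jumpCov p)⁻¹ (q.1 - q.2)) / (2 * (t : ℝ))) *
            φ q.1 * φ q.2 := by
    rw [← integral_const_mul]
    refine integral_congr_ae (Eventually.of_forall fun q => ?_)
    simp only
    rw [heatKernel_pow hp.posDef_jumpCov.det_pos.le t.coe_nonneg, quadForm_sub_comm _ q.1]
    ring
  rw [e] at h
  have e2 : ∀ a b c d : ℝ, a * (b * (c * d)) = b * a * c * d := fun a b c d => by ring
  rw [e2] at h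
  refine h.congr' ?_
  filter_upwards [eventually_gt_atTop 0] with N hN
  obtain ⟨κ, Z, hκ1, hκ, hE⟩ := hη.exists_evolution hp ((N : ℝ≥0) ^ 2 * t)
  rw [(hE.field_correlation hp hκ hρ c hN x φ).2, ← Finset.mul_sum]
  ring

lemma quadForm_smul_one (a : ℝ) (v : EuclideanSpace ℝ (Fin d)) :
    quadForm (a • (1 : Matrix (Fin d) (Fin d) ℝ)) v = a * ‖v‖ ^ 2 := by
  rw [quadForm, Matrix.smul_mulVec, Matrix.one_mulVec, dotProduct_smul, smul_eq_mul,
    EuclideanSpace.real_norm_sq_eq, dotProduct]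
  simp only [sq]

end ScalingLimit

end IRW

theorem theorem3p3 {d k : ℕ} (hd : 1 ≤ d) (p : IRW.Lattice d → IRW.Lattice d → ℝ)
    (hp : IRW.IsWalkKernel p) (ρ : ℝ≥0) (hρ : 0 < ρ) (c : ℝ) (hc : c ≠ 0)
    {Ω : Type*} [MeasurableSpace Ω] (P : Measure Ω) [IsProbabilityMeasure P]
    (η : ℝ≥0 → Ω → IRW.Config d) (hη : IRW.IsEquilibriumWalkers p ρ P η)
    (x : Fin k → IRW.Lattice d) (φ : SchwartzMap (EuclideanSpace ℝ (Fin d)) ℝ) :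
    (∀ N : ℕ, 0 < N → ∀ t : ℝ≥0, 0 < t →
      (∀ᵐ ω ∂P, Summable (IRW.fieldTerm ρ c N x (η t ω) φ) ∧
        Summable (IRW.fieldTerm ρ c N x (η 0 ω) φ)) ∧
      Integrable (fun ω => IRW.field ρ c N x (η t ω) φ * IRW.field ρ c N x (η 0 ω) φ) P ∧
      (∀ σ : IRW.PermClass x, Summable fun q : IRW.Lattice d × IRW.Lattice d =>
        φ (IRW.scaled N q.1) * φ (IRW.scaled N q.2) *
          IRW.labeledProb p t x (IRW.shift (q.2 - q.1) (IRW.permuted x σ))) ∧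
      ∫ ω, IRW.field ρ c N x (η t ω) φ * IRW.field ρ c N x (η 0 ω) φ ∂P =
        IRW.dualityNormSq ρ c (IRW.configOf x) *
          ∑ σ : IRW.PermClass x, ∑' q : IRW.Lattice d × IRW.Lattice d,
            φ (IRW.scaled N q.1) * φ (IRW.scaled N q.2) *
              IRW.labeledProb p t x (IRW.shift (q.2 - q.1) (IRW.permuted x σ))) ∧
    (∀ t : ℝ≥0, 0 < t →
      Tendsto (fun N : ℕ => (N : ℝ) ^ ((d : ℤ) * ((k : ℤ) - 2)) *
          ∫ ω, IRW.field ρ c N x (η ((N : ℝ≥0) ^ 2 * t) ω) φ * IRW.field ρ c N x (η 0 ω) φ ∂P)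
        atTop
        (𝓝 ((Fintype.card (IRW.PermClass x) : ℝ) * IRW.dualityNormSq ρ c (IRW.configOf x) *
          ((IRW.jumpCov p).det ^ (-(k : ℝ) / 2) *
            (2 * Real.pi * (t : ℝ)) ^ (-((d : ℝ) * (k : ℝ)) / 2)) *
          ∫ q : EuclideanSpace ℝ (Fin d) × EuclideanSpace ℝ (Fin d),
            Real.exp (-((k : ℝ) * IRW.quadForm (IRW.jumpCov p)⁻¹ (q.1 - q.2)) / (2 * (t : ℝ))) *
              φ q.1 * φ q.2))) ∧
    (IRW.jumpCov p = (1 / (d : ℝ)) • (1 : Matrix (Fin d) (Fin d) ℝ) →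
      ∀ t : ℝ≥0, 0 < t →
      Tendsto (fun N : ℕ => (N : ℝ) ^ ((d : ℤ) * ((k : ℤ) - 2)) *
          ∫ ω, IRW.field ρ c N x (η ((N : ℝ≥0) ^ 2 * t) ω) φ * IRW.field ρ c N x (η 0 ω) φ ∂P)
        atTop
        (𝓝 ((Fintype.card (IRW.PermClass x) : ℝ) * IRW.dualityNormSq ρ c (IRW.configOf x) *
          ((d : ℝ) ^ ((d : ℝ) * (k : ℝ) / 2) /
            (2 * Real.pi * (t : ℝ)) ^ ((d : ℝ) * (k : ℝ) / 2)) *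
          ∫ q : EuclideanSpace ℝ (Fin d) × EuclideanSpace ℝ (Fin d),
            Real.exp (-((k : ℝ) * (d : ℝ) * ‖q.1 - q.2‖ ^ 2) / (2 * (t : ℝ))) *
              φ q.1 * φ q.2))) := by
  refine ⟨fun N hN t _ => ?_, fun t ht => hη.tendsto_field_correlation hp hρ c x φ ht,
    fun hΓ t ht => ?_⟩
  · obtain ⟨κ, Z, hκ1, hκ, hE⟩ := hη.exists_evolution hp t
    refine ⟨?_, (hE.field_correlation hp hκ hρ c hN x φ).1,
      IRW.summable_mul_labeledProb hp hκ hN x φ, (hE.field_correlation hp hκ hρ c hN x φ).2⟩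
    filter_upwards [IRW.ae_summable_fieldTerm c hN x φ (hE.exists_integral_abs_duality_one_le c k),
      IRW.ae_summable_fieldTerm c hN x φ (hE.exists_integral_abs_duality_zero_le c k)]
      with ω h1 h0
    exact ⟨h1, h0⟩
  · have hd' : (d : ℝ) ≠ 0 := by positivity
    have h := hη.tendsto_field_correlation hp hρ c x φ ht
    have hinv : (IRW.jumpCov p)⁻¹ = (d : ℝ) • (1 : Matrix (Fin d) (Fin d) ℝ) := by
      rw [hΓ]
      refine Matrix.inv_eq_left_inv ?_
      rw [smul_mul_smul_comm, mul_one_div_cancel hd', mul_one, one_smul]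
    have hdet : (IRW.jumpCov p).det ^ (-(k : ℝ) / 2) = (d : ℝ) ^ ((d : ℝ) * (k : ℝ) / 2) := by
      rw [hΓ, Matrix.det_smul, Matrix.det_one, mul_one, Fintype.card_fin, one_div, inv_pow,
        Real.inv_rpow (by positivity), ← Real.rpow_neg (by positivity), ← Real.rpow_natCast,
        ← Real.rpow_mul (by positivity)]
      congr 1
      ring
    rw [hdet, neg_div, Real.rpow_neg (by positivity), ← div_eq_mul_inv] at h
    simpa only [hinv, IRW.quadForm_smul_one, mul_assoc] using h
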